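/- Let $0<\beta\le 1$. There is a constant $C$, depending only on $\beta$, with the following property. Let $\Sigma_1,\Sigma_2,\Sigma_3\subset\mathbb{R}^3$ be nonempty sets with $\operatorname{diam}\Sigma_i\le 1$ such that for $i=1,2,3$ there are an open convex set $U_i\subset\mathbb{R}^3$ and a function $\Phi_i\in C^{1,\beta}(U_i)$ such that $\Sigma_i$ is a relatively open subset of the surface $$\Sigma_i^*=\{\sigma\in U_i \mid \Phi_i(\sigma)=0,\ \nabla\Phi_i(\sigma)\neq 0\},\qquad \operatorname{dist}(\Sigma_i,U_i^c)\ge \operatorname{diam}(\Sigma_i),$$ and such that, for suitable unit normal vector fields $\mathfrak n_i$ on $\Sigma_i^*$, $$\sup_{\sigma\ne\tilde\sigma\in\Sigma_i^*}\left(\frac{|\mathfrak n_i(\sigma)-\mathfrak n_i(\tilde\sigma)|}{|\sigma-\tilde\sigma|^{\beta}}+\frac{|\mathfrak n_i(\sigma)\cdot(\sigma-\tilde\sigma)|}{|\sigma-\tilde\sigma|^{1+\beta}}\right)\le 1\qquad(i=1,2,3)$$ and $$\tfrac12\le\det\big(\mathfrak n_1(\sigma_1),\mathfrak n_2(\sigma_2),\mathfrak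 n_3(\sigma_3)\big)\le 1\qquad\text{for all }(\sigma_1,\sigma_2,\sigma_3)\in\Sigma_1^*\times\Sigma_2^*\times\Sigma_3^*.$$ Let $\mu_i$ be the surface measure on $\Sigma_i$ and $L^2(\Sigma_i)=L^2(\Sigma_i,\mu_i)$ (complex-valued functions). For $f\in L^2(\Sigma_1)$, $g\in L^2(\Sigma_2)$ let $f\ast g$ be the distribution $$(f\ast g)(\psi)=\int_{\Sigma_1}\int_{\Sigma_2} f(x)\,g(y)\,\psi(x+y)\,d\mu_2(y)\,d\mu_1(x),\qquad \psi\in C_c^\infty(\mathbb{R}^3).$$ Then: (a) If $f\in C_c(\Sigma_1)$ and $g\in C_c(\Sigma_2)$, then $f\ast g$ is a continuous function of compact support on $\mathbb{R}^3$; in particular it can be restricted to $\Sigma_3$ pointwise. (b) For each $f\in L^2(\Sigma_1)$ and $g\in L^2(\Sigma_2)$ the restriction of $f\ast g$ to $\Sigma_3$ is a well-defined function in $L^2(\Sigma_3)$: there is a unique element of $L^2(\Sigma_3)$, denoted $(f\ast g)|_{\Sigma_3}$, such that $(f_k\ast g_k)|_{\Sigma_3}\to (f\ast g)|_{\Sigma_3}$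 in $L^2(\Sigma_3)$ for all sequences $f_k\in C_c(\Sigma_1)$, $g_k\in C_c(\Sigma_2)$ with $f_k\to f$ in $L^2(\Sigma_1)$ and $g_k\to g$ in $L^2(\Sigma_2)$. It satisfies $$\|f\ast g\|_{L^2(\Sigma_3)}\le C\,\|f\|_{L^2(\Sigma_1)}\|g\|_{L^2(\Sigma_2)}.$$ -/

import Mathlib

open MeasureTheory Filter Topology
open scoped NNReal ENNReal ContDiff

/-- Three-dimensional Euclidean space. -/
abbrev E3 : Type := EuclideanSpace ℝ (Fin 3)

/-- `Φ` is of class `C^{1,β}` on the open set `U`: it is continuously differentiable there and its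
gradient is locally Hölder continuous of exponent `β`. (A global Hölder bound for the gradient
implies this.) -/
def IsC1Holder (β : ℝ≥0) (U : Set E3) (Φ : E3 → ℝ) : Prop :=
  ContDiffOn ℝ 1 Φ U ∧
    ∀ x ∈ U, ∃ C : ℝ≥0, ∃ V ∈ 𝓝 x, HolderOnWith C β (gradient Φ) V

/-- The surface `{σ ∈ U | Φ σ = 0, ∇Φ σ ≠ 0}`. -/
def levelSurface (U : Set E3) (Φ : E3 → ℝ) : Set E3 :=
  {σ | σ ∈ U ∧ Φ σ = 0 ∧ gradient Φ σ ≠ 0}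

/-- `S` is a nonempty bounded relatively open piece of the larger surface
`S* = levelSurface U Φ`, oriented by the unit normal field `n`. -/
structure IsSurfacePiece (β : ℝ≥0) (b : ℝ) (S U : Set E3) (Φ : E3 → ℝ) (n : E3 → E3) :
    Prop where
  nonempty : S.Nonempty
  bounded : Bornology.IsBounded S
  relOpen : ∃ V : Set E3, IsOpen V ∧ S = levelSurface U Φ ∩ V
  isOpen_U : IsOpen U
  convex_U : Convex ℝ U
  regular : IsC1Holder β U Φ
  /-- `dist (S, Uᶜ) ≥ diam S` (void if `U` is the whole space) -/
  dist_compl : ∀ x ∈ S, ∀ y ∈ Uᶜ, Metric.diam S ≤ dist x y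
  norm_normal : ∀ σ ∈ levelSurface U Φ, ‖n σ‖ = 1
  normal_dir : ∀ σ ∈ levelSurface U Φ, ∃ c : ℝ, n σ = c • gradient Φ σ
  holder : ∀ σ ∈ levelSurface U Φ, ∀ τ ∈ levelSurface U Φ, σ ≠ τ →
    ‖n σ - n τ‖ / ‖σ - τ‖ ^ (β : ℝ) + |inner ℝ (n σ) (σ - τ)| / ‖σ - τ‖ ^ (1 + (β : ℝ)) ≤ b

/-- The standing assumption on a triple of surfaces, with Hölder exponent `β`, Hölder constant `b`
and transversality constant `θ`. The matrix in the last clause has the columns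
`n 0 (σ 0)`, `n 1 (σ 1)`, `n 2 (σ 2)`. -/
def TransversalTriple (β : ℝ≥0) (b θ : ℝ) (S : Fin 3 → Set E3) : Prop :=
  ∃ (U : Fin 3 → Set E3) (Φ : Fin 3 → E3 → ℝ) (n : Fin 3 → E3 → E3),
    (∀ i, IsSurfacePiece β b (S i) (U i) (Φ i) (n i)) ∧
    ∀ σ : Fin 3 → E3, (∀ i, σ i ∈ levelSurface (U i) (Φ i)) →
      θ ≤ (Matrix.of fun k i => n i (σ i) k).det ∧
        (Matrix.of fun k i => n i (σ i) k).det ≤ 1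

/-- Surface measure on `S`: the two-dimensional Hausdorff measure, normalized to agree with area on
planes, restricted to `S`. -/
noncomputable def surfaceMeasure (S : Set E3) : Measure E3 :=
  (Measure.euclideanHausdorffMeasure 2 : Measure E3).restrict S

/-- `f` is (the extension by zero of) a continuous function on `S` whose support is a compact
subset of `S`. -/
def IsCcOn (S : Set E3) (f : E3 → ℂ) : Prop :=
  ContinuousOn f S ∧ ∃ K : Set E3, IsCompact K ∧ K ⊆ S ∧ ∀ x, x ∉ K → f x = 0

/-- The convolution of `f dμ₁` and `g dμ₂`, with `μᵢ` the surface measure of `Sᵢ`, as a functional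
on test functions. -/
noncomputable def surfaceConv (S₁ S₂ : Set E3) (f g ψ : E3 → ℂ) : ℂ :=
  ∫ x, ∫ y, f x * g y * ψ (x + y) ∂(surfaceMeasure S₂) ∂(surfaceMeasure S₁)

/-- The distribution `f ∗ g` is the continuous function `h` of compact support. (Such an `h` is
unique.) -/
def IsContinuousConv (S₁ S₂ : Set E3) (f g h : E3 → ℂ) : Prop :=
  Continuous h ∧ HasCompactSupport h ∧
    ∀ ψ : E3 → ℂ, ContDiff ℝ ∞ ψ → HasCompactSupport ψ →
      ∫ v, h v * ψ v = surfaceConv S₁ S₂ f g ψ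

/-- `F` is the restriction of `f ∗ g` to `S₃`, defined by density: for any approximation of `f` and
`g` in `L²` by continuous functions of compact support in the surfaces, the pointwise restrictions
to `S₃` of the (continuous) convolutions converge to `F` in `L²(S₃)`. -/
def IsConvRestriction (S₁ S₂ S₃ : Set E3) (f : Lp ℂ 2 (surfaceMeasure S₁))
    (g : Lp ℂ 2 (surfaceMeasure S₂)) (F : Lp ℂ 2 (surfaceMeasure S₃)) : Prop :=
  ∀ φ γ h : ℕ → E3 → ℂ,
    (∀ k, IsCcOn S₁ (φ k)) → (∀ k, IsCcOn S₂ (γ k)) →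
    (∀ k, IsContinuousConv S₁ S₂ (φ k) (γ k) (h k)) →
    Tendsto (fun k => eLpNorm (fun x => φ k x - f x) 2 (surfaceMeasure S₁)) atTop (𝓝 0) →
    Tendsto (fun k => eLpNorm (fun x => γ k x - g x) 2 (surfaceMeasure S₂)) atTop (𝓝 0) →
    Tendsto (fun k => eLpNorm (fun x => h k x - F x) 2 (surfaceMeasure S₃)) atTop (𝓝 0)

/-!
Locally each surface is a graph, with a chart `Gᵢ` over a plane domain. Since the normals of `S 0`
and `S 1` are linearly independent, `(u, v) ↦ G₀ u + G₁ v` is a submersion, and the push-forward of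
a continuous compactly supported density under a submersion has a continuous density: this is
`f ∗ g`.

For the `L²` bound, mollify `f ∗ g` with a kernel `k` of height `O(ε⁻³)` supported in the `ε`-ball.
By Cauchy–Schwarz and Fubini it suffices to bound, uniformly in `p` and `q`,
`∫ z in S₂, (∫ y in S₁, k (z - p - y)) * (∫ x in S₀, k (z - q - x))`.
Both inner integrals are `O(ε⁻³ ε²)`, and they vanish unless `z` lies within `ε` of `p + S₁` and of
`q + S₀`. The lower bound on the determinant of the normals confines such `z ∈ S₂` to boundedly many
sets of diameter `O(ε)`, of total area `O(ε²)`, so the powers of `ε` cancel. Fatou's lemma gives the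
bound for `f ∗ g` as `ε → 0`, and the extension to `L²` is by density.
-/

/-! ### The area formula -/

section LocalComparison

variable {X : Type*} [TopologicalSpace X] [MeasurableSpace X] {μ ν : Measure X} {B : Set X}

theorem exists_nhds_setLIntegral_comparable {f : X → ℝ≥0∞} {x : X} (hf : ContinuousAt f x)
    (h0 : f x ≠ 0) (htop : f x ≠ ⊤) {K : ℝ≥0} (hK : 1 < K) :
    ∃ V ∈ 𝓝 x, ∀ A ⊆ V, MeasurableSet A →
      f x * μ A ≤ K * ∫⁻ y in A, f y ∂μ ∧ ∫⁻ y in A, f y ∂μ ≤ K * (f x * μ A) := by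
  have hlt : f x < K * f x := by
    simpa using ENNReal.mul_lt_mul_left h0 htop (ENNReal.one_lt_coe_iff.2 hK)
  have hKf : ContinuousAt (fun y => K * f y) x :=
    ENNReal.Tendsto.const_mul hf (Or.inl h0)
  refine ⟨_, (hKf.eventually_const_lt hlt).and (hf.eventually_lt_const hlt),
    fun A hA hAm => ⟨?_, ?_⟩⟩
  · rw [← setLIntegral_const, ← lintegral_const_mul' _ _ ENNReal.coe_ne_top]
    exact setLIntegral_mono' hAm fun y hy => (hA hy).1.le
  · rw [← setLIntegral_const, ← lintegral_const_mul' _ _ ENNReal.coe_ne_top]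
    exact setLIntegral_mono' hAm fun y hy => (hA hy).2.le

variable [OpensMeasurableSpace X] [SecondCountableTopology X]

theorem measure_le_of_locally_le (hB : MeasurableSet B)
    (h : ∀ x ∈ B, ∃ V ∈ 𝓝[B] x, ∀ A ⊆ V, MeasurableSet A → μ A ≤ ν A) : μ B ≤ ν B := by
  rcases B.eq_empty_or_nonempty with rfl | hne
  · simp
  choose! V hV hle using h
  choose! W hWo hxW hWV using fun x hx => mem_nhdsWithin.1 (hV x hx)
  obtain ⟨t, htB, htc, ht⟩ := TopologicalSpace.countable_cover_nhdsWithin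
    fun x hx => mem_nhdsWithin_of_mem_nhds ((hWo x hx).mem_nhds (hxW x hx))
  have htne : t.Nonempty := by
    obtain ⟨x, hx⟩ := hne
    obtain ⟨y, hy, -⟩ := Set.mem_iUnion₂.1 (ht hx)
    exact ⟨y, hy⟩
  obtain ⟨s, rfl⟩ := htc.exists_eq_range htne
  have hsB : ∀ n, s n ∈ B := fun n => htB ⟨n, rfl⟩
  let D : ℕ → Set X := disjointed fun n => W (s n)
  have hDm : ∀ n, MeasurableSet (B ∩ D n) := fun n =>
    hB.inter (MeasurableSet.disjointed (fun n => (hWo _ (hsB n)).measurableSet) n)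
  have hdisj : Pairwise (Function.onFun Disjoint fun n => B ∩ D n) := fun i j hij =>
    (disjoint_disjointed _ hij).mono Set.inter_subset_right Set.inter_subset_right
  have hBD : B = ⋃ n, B ∩ D n := by
    rw [← Set.inter_iUnion, iUnion_disjointed, Set.inter_eq_left.2]
    simpa only [Set.biUnion_range] using ht
  rw [hBD, measure_iUnion hdisj hDm, measure_iUnion hdisj hDm]
  refine ENNReal.tsum_le_tsum fun n => hle (s n) (hsB n) _ ?_ (hDm n)
  exact fun x hx => hWV _ (hsB n) ⟨disjointed_subset _ n hx.2, hx.1⟩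

theorem ennreal_le_of_forall_one_lt_pow_mul {x y : ℝ≥0∞} (n : ℕ)
    (h : ∀ K : ℝ≥0, 1 < K → x ≤ (K : ℝ≥0∞) ^ n * y) : x ≤ y := by
  have hlim : Tendsto (fun K : ℝ≥0 => (K : ℝ≥0∞) ^ n * y) (𝓝[>] 1) (𝓝 (1 * y)) := by
    refine ENNReal.Tendsto.mul_const ?_ (Or.inl one_ne_zero)
    have : Tendsto (fun K : ℝ≥0 => (K : ℝ≥0∞) ^ n) (𝓝 1) (𝓝 (((1 : ℝ≥0) : ℝ≥0∞) ^ n)) :=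
      ((ENNReal.continuous_pow n).comp ENNReal.continuous_coe).tendsto 1
    simpa using this.mono_left nhdsWithin_le_nhds
  rw [one_mul] at hlim
  exact ge_of_tendsto hlim (eventually_mem_nhdsWithin.mono h)

theorem measure_eq_of_locally_comparable (hB : MeasurableSet B) (n : ℕ)
    (h : ∀ K : ℝ≥0, 1 < K → ∀ x ∈ B, ∃ V ∈ 𝓝[B] x, ∀ A ⊆ V, MeasurableSet A →
      μ A ≤ (K : ℝ≥0∞) ^ n * ν A ∧ ν A ≤ (K : ℝ≥0∞) ^ n * μ A) : μ B = ν B := by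
  apply le_antisymm <;> refine ennreal_le_of_forall_one_lt_pow_mul n fun K hK => ?_ <;>
    rw [← smul_eq_mul, ← Measure.smul_apply] <;>
    refine measure_le_of_locally_le hB fun x hx => (h K hK x hx).imp fun V hV =>
      ⟨hV.1, fun A hA hAm => ?_⟩
  exacts [(hV.2 A hA hAm).1, (hV.2 A hA hAm).2]

end LocalComparison

theorem euclideanHausdorffMeasure_image_le_of_dist_le {X Y Z : Type*} [MetricSpace Y]
    [MeasurableSpace Y] [BorelSpace Y] [MetricSpace Z] [MeasurableSpace Z] [BorelSpace Z]
    (d : ℕ) {f : X → Y} {g : X → Z} {K : ℝ≥0} {B : Set X}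
    (h : ∀ x ∈ B, ∀ y ∈ B, dist (f x) (f y) ≤ K * dist (g x) (g y)) :
    μHE[d] (f '' B) ≤ (K : ℝ≥0∞) ^ d * μHE[d] (g '' B) := by
  rcases isEmpty_or_nonempty X with hX | hX
  · simp [Set.eq_empty_of_isEmpty B]
  let F : Z → Y := f ∘ Function.invFunOn g B
  have hF : ∀ x ∈ B, F (g x) = f x := fun x hx => by
    have hg : g (Function.invFunOn g B (g x)) = g x := Function.invFunOn_eq ⟨x, hx, rfl⟩
    have := h _ (Function.invFunOn_mem (f := g) ⟨x, hx, rfl⟩) x hx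
    rw [hg, dist_self, mul_zero] at this
    exact dist_le_zero.1 this
  have hlip : LipschitzOnWith K F (g '' B) := by
    refine LipschitzOnWith.of_dist_le_mul ?_
    rintro _ ⟨x, hx, rfl⟩ _ ⟨y, hy, rfl⟩
    rw [hF x hx, hF y hy]
    exact h x hx y hy
  have himage : f '' B = F '' (g '' B) := by
    rw [Set.image_image]
    exact Set.image_congr fun x hx => (hF x hx).symm
  have hle := hlip.hausdorffMeasure_image_le (d := d) d.cast_nonneg
  rw [ENNReal.rpow_natCast] at hle
  rw [himage, Measure.euclideanHausdorffMeasure_def, Measure.euclideanHausdorffMeasure_def,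
    Measure.smul_apply, Measure.smul_apply, mul_smul_comm]
  gcongr

section AreaFormula

variable {U V : Type*} [NormedAddCommGroup U] [InnerProductSpace ℝ U] [FiniteDimensional ℝ U]
  [NormedAddCommGroup V] [InnerProductSpace ℝ V]

theorem continuous_normDet [CompleteSpace V] :
    Continuous fun f : U →L[ℝ] V => (f : U →ₗ[ℝ] V).normDet := by
  have : CompleteSpace U := FiniteDimensional.complete ℝ U
  have hsqrt : (fun f : U →L[ℝ] V => (f : U →ₗ[ℝ] V).normDet) =
      fun f => √((ContinuousLinearMap.adjoint f ∘L f).det) := by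
    ext f
    rw [← ContinuousLinearMap.normDet_sq]
    exact (Real.sqrt_sq (LinearMap.normDet_nonneg _)).symm
  rw [hsqrt]
  refine Real.continuous_sqrt.comp (ContinuousLinearMap.continuous_det.comp ?_)
  exact (ContinuousLinearMap.adjoint (𝕜 := ℝ) (E := U) (F := V)).continuous.clm_comp continuous_id

theorem normDet_pos_of_injective {A : U →ₗ[ℝ] V} (hA : Function.Injective A) : 0 < A.normDet := by
  refine (LinearMap.normDet_nonneg _).lt_of_ne' ?_
  rwa [Ne, LinearMap.normDet_eq_zero_iff_ker_ne_bot, not_not, LinearMap.ker_eq_bot]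

theorem exists_nhds_norm_sub_comparable {G : U → V} {A : U →L[ℝ] V} {u : U}
    (hG : HasStrictFDerivAt G A u) (hA : Function.Injective A) {K : ℝ} (hK : 1 < K) :
    ∃ W ∈ 𝓝 u, ∀ x ∈ W, ∀ y ∈ W, ‖G x - G y‖ ≤ K * ‖A x - A y‖ ∧
      ‖A x - A y‖ ≤ K * ‖G x - G y‖ := by
  obtain ⟨k, hk, hkA⟩ := LinearMap.exists_antilipschitzWith (A : U →ₗ[ℝ] V)
    (LinearMap.ker_eq_bot.2 hA)
  have hk' : (0 : ℝ) < k := hk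
  -- `η` is small enough for both `1 + η ≤ K` and `(1 - η)⁻¹ ≤ K`.
  set η : ℝ := (K - 1) / K with hη
  have hη0 : 0 < η / k := div_pos (div_pos (by linarith) (by linarith)) hk'
  obtain ⟨W, hW, happrox⟩ := hG.approximates_deriv_on_nhds (Or.inr (Real.toNNReal_pos.2 hη0))
  refine ⟨W, hW, fun x hx y hy => ?_⟩
  have hdiff : ‖G x - G y - (A x - A y)‖ ≤ η * ‖A x - A y‖ := by
    have hxy : ‖x - y‖ ≤ k * ‖A x - A y‖ := by
      simpa [dist_eq_norm] using hkA.le_mul_dist x y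
    have happ := happrox x hx y hy
    rw [Real.coe_toNNReal _ hη0.le, map_sub] at happ
    calc ‖G x - G y - (A x - A y)‖ ≤ η / k * (k * ‖A x - A y‖) := happ.trans (by gcongr)
      _ = η * ‖A x - A y‖ := by field_simp
  have hKη : K * η = K - 1 := by rw [hη]; field_simp
  constructor
  · have hupper : ‖G x - G y‖ ≤ (1 + η) * ‖A x - A y‖ := by
      linarith [norm_le_norm_add_norm_sub' (G x - G y) (A x - A y)]
    exact hupper.trans (by gcongr; nlinarith)
  · have hlower : (1 - η) * ‖A x - A y‖ ≤ ‖G x - G y‖ := by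
      linarith [norm_le_norm_add_norm_sub (G x - G y) (A x - A y)]
    calc ‖A x - A y‖ = K * ((1 - η) * ‖A x - A y‖) := by
          rw [← mul_assoc, mul_one_sub, hKη, sub_sub_cancel, one_mul]
      _ ≤ K * ‖G x - G y‖ := by gcongr

/-- `G` is an injective immersion of class `C¹` of the open set `Ω`: the hypothesis of the area
formula, and the analytic part of a parametrisation of a surface. -/
structure IsInjImmersionOn (G : U → V) (Ω : Set U) : Prop where
  isOpen : IsOpen Ω
  contDiffOn : ContDiffOn ℝ 1 G Ω
  injOn : Set.InjOn G Ω
  injective_fderiv : ∀ u ∈ Ω, Function.Injective (fderiv ℝ G u)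

variable {G : U → V} {Ω : Set U}

theorem IsInjImmersionOn.continuousOn_normDet [CompleteSpace V] (h : IsInjImmersionOn G Ω) :
    ContinuousOn (fun u => (fderiv ℝ G u : U →ₗ[ℝ] V).normDet) Ω :=
  continuous_normDet.comp_continuousOn (h.contDiffOn.continuousOn_fderiv_of_isOpen h.isOpen le_rfl)

variable [MeasurableSpace U] [BorelSpace U] [MeasurableSpace V] [BorelSpace V]

theorem exists_nhds_euclideanHausdorffMeasure_image_comparable {A : U →L[ℝ] V}
    {u : U} (hG : HasStrictFDerivAt G A u) (hA : Function.Injective A) {K : ℝ≥0} (hK : 1 < K) :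
    ∃ W ∈ 𝓝 u, ∀ B ⊆ W,
      μHE[Module.finrank ℝ U] (G '' B) ≤ (K : ℝ≥0∞) ^ Module.finrank ℝ U *
        (ENNReal.ofReal (A : U →ₗ[ℝ] V).normDet * volume B) ∧
      ENNReal.ofReal (A : U →ₗ[ℝ] V).normDet * volume B ≤
        (K : ℝ≥0∞) ^ Module.finrank ℝ U * μHE[Module.finrank ℝ U] (G '' B) := by
  obtain ⟨W, hW, hGA⟩ := exists_nhds_norm_sub_comparable hG hA (NNReal.one_lt_coe.2 hK)
  simp only [← dist_eq_norm] at hGA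
  refine ⟨W, hW, fun B hB => ?_⟩
  have hvol : μHE[Module.finrank ℝ U] (A '' B) = _ :=
    LinearMap.euclideanHausdorffMeasure_image_eq_normDet_mul_volume (A : U →ₗ[ℝ] V) B
  rw [← hvol]
  exact ⟨euclideanHausdorffMeasure_image_le_of_dist_le _
      fun x hx y hy => (hGA x (hB hx) y (hB hy)).1,
    euclideanHausdorffMeasure_image_le_of_dist_le _
      fun x hx y hy => (hGA x (hB hx) y (hB hy)).2⟩

namespace IsInjImmersionOn

theorem measurableEmbedding (h : IsInjImmersionOn G Ω) : MeasurableEmbedding (Ω.domRestrict G) :=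
  h.contDiffOn.continuousOn.measurableEmbedding h.isOpen.measurableSet h.injOn

variable [CompleteSpace V]

theorem exists_nhds_image_comparable (h : IsInjImmersionOn G Ω) {u : U} (hu : u ∈ Ω) {K : ℝ≥0}
    (hK : 1 < K) :
    ∃ W ∈ 𝓝 u, ∀ B ⊆ W, MeasurableSet B →
      μHE[Module.finrank ℝ U] (G '' B) ≤ (K : ℝ≥0∞) ^ (Module.finrank ℝ U + 1) *
        ∫⁻ x in B, ENNReal.ofReal (fderiv ℝ G x : U →ₗ[ℝ] V).normDet ∧
      ∫⁻ x in B, ENNReal.ofReal (fderiv ℝ G x : U →ₗ[ℝ] V).normDet ≤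
        (K : ℝ≥0∞) ^ (Module.finrank ℝ U + 1) * μHE[Module.finrank ℝ U] (G '' B) := by
  have hΩ := h.isOpen.mem_nhds hu
  obtain ⟨W, hW, hWG⟩ := exists_nhds_euclideanHausdorffMeasure_image_comparable
    ((h.contDiffOn.contDiffAt hΩ).hasStrictFDerivAt one_ne_zero) (h.injective_fderiv u hu) hK
  obtain ⟨W', hW', hWJ⟩ := exists_nhds_setLIntegral_comparable (μ := volume)
    (ENNReal.continuous_ofReal.continuousAt.comp (h.continuousOn_normDet.continuousAt hΩ))
    (ENNReal.ofReal_pos.2 (normDet_pos_of_injective (h.injective_fderiv u hu))).ne'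
    ENNReal.ofReal_ne_top hK
  refine ⟨W ∩ W', inter_mem hW hW', fun B hB hBm => ?_⟩
  obtain ⟨hG₁, hG₂⟩ := hWG B (hB.trans Set.inter_subset_left)
  obtain ⟨hJ₁, hJ₂⟩ := hWJ B (hB.trans Set.inter_subset_right) hBm
  simp only [Function.comp_apply] at hJ₁ hJ₂
  constructor
  · rw [pow_succ, mul_assoc]
    exact hG₁.trans (by gcongr)
  · rw [pow_succ', mul_assoc]
    exact hJ₂.trans (by gcongr)

theorem euclideanHausdorffMeasure_image (h : IsInjImmersionOn G Ω) {B : Set U}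
    (hB : MeasurableSet B) (hBΩ : B ⊆ Ω) :
    μHE[Module.finrank ℝ U] (G '' B) =
      ∫⁻ x in B, ENNReal.ofReal (fderiv ℝ G x : U →ₗ[ℝ] V).normDet := by
  let ν : Measure U :=
    ((μHE[Module.finrank ℝ U] : Measure V).comap (Ω.domRestrict G)).map Subtype.val
  have hν : ∀ A ⊆ Ω, MeasurableSet A → ν A = μHE[Module.finrank ℝ U] (G '' A) := by
    intro A hA hAm
    rw [Measure.map_apply measurable_subtype_coe hAm, h.measurableEmbedding.comap_apply,
      Set.image_domRestrict, Set.inter_eq_left.2 hA]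
  rw [← hν B hBΩ hB, ← withDensity_apply _ hB]
  refine measure_eq_of_locally_comparable hB (Module.finrank ℝ U + 1) fun K hK u hu => ?_
  obtain ⟨W, hW, hcomp⟩ := h.exists_nhds_image_comparable (hBΩ hu) hK
  refine ⟨W ∩ Ω, mem_nhdsWithin_of_mem_nhds (inter_mem hW (h.isOpen.mem_nhds (hBΩ hu))),
    fun A hA hAm => ?_⟩
  rw [hν A (hA.trans Set.inter_subset_right) hAm, withDensity_apply _ hAm]
  exact hcomp A (hA.trans Set.inter_subset_left) hAm

theorem map_domRestrict_withDensity_normDet (h : IsInjImmersionOn G Ω) :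
    ((volume.withDensity fun x => ENNReal.ofReal (fderiv ℝ G x : U →ₗ[ℝ] V).normDet).comap
      Subtype.val).map (Ω.domRestrict G) =
    (μHE[Module.finrank ℝ U] : Measure V).restrict (G '' Ω) := by
  have hsub := MeasurableEmbedding.subtype_coe h.isOpen.measurableSet
  ext s hs
  have hm : MeasurableSet (Subtype.val '' (Ω.domRestrict G ⁻¹' s)) :=
    hsub.measurableSet_image.2 (h.measurableEmbedding.measurable hs)
  rw [Measure.map_apply h.measurableEmbedding.measurable hs, hsub.comap_apply,
    withDensity_apply _ hm, Measure.restrict_apply hs,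
    ← h.euclideanHausdorffMeasure_image hm (Subtype.coe_image_subset _ _),
    Set.domRestrict_eq, Set.preimage_comp, Subtype.image_preimage_coe, Set.inter_comm,
    Set.image_preimage_inter]

theorem setIntegral_image {F : Type*} [NormedAddCommGroup F] [NormedSpace ℝ F]
    (h : IsInjImmersionOn G Ω) (k : V → F) :
    ∫ y in G '' Ω, k y ∂μHE[Module.finrank ℝ U] =
      ∫ u in Ω, (fderiv ℝ G u : U →ₗ[ℝ] V).normDet • k (G u) := by
  have hΩ := h.isOpen.measurableSet
  rw [← h.map_domRestrict_withDensity_normDet, h.measurableEmbedding.integral_map]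
  simp only [Set.domRestrict_apply, ENNReal.ofReal]
  rw [integral_subtype_comap hΩ fun u => k (G u),
    setIntegral_withDensity_eq_setIntegral_smul₀
      (h.continuousOn_normDet.aemeasurable hΩ).real_toNNReal _ hΩ]
  simp only [NNReal.smul_def, Real.coe_toNNReal _ (LinearMap.normDet_nonneg _)]

end IsInjImmersionOn

end AreaFormula

/-! ### Push-forward of continuous densities under submersions -/

theorem tsupport_subset_of_eq_zero_off {X E : Type*} [TopologicalSpace X] [Zero E] {f : X → E}
    {K : Set X} (hK : IsClosed K) (h0 : ∀ x ∉ K, f x = 0) : tsupport f ⊆ K :=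
  closure_minimal (fun x hx => by_contra fun hxK => hx (h0 x hxK)) hK

theorem exists_partition_of_unity_of_isCompact {X : Type*} [TopologicalSpace X] [T2Space X]
    [LocallyCompactSpace X] {K : Set X} (hK : IsCompact K) {p : Set X → Prop}
    (h : ∀ x ∈ K, ∃ V, IsOpen V ∧ x ∈ V ∧ p V) :
    ∃ (n : ℕ) (χ : Fin n → C(X, ℝ)), (∀ i, ∃ V, IsOpen V ∧ p V ∧ tsupport (χ i) ⊆ V) ∧
      ∀ x ∈ K, ∑ i, χ i x = 1 := by
  choose! V hVo hxV hpV using h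
  obtain ⟨t, htK, hcover⟩ := hK.elim_nhds_subcover V fun x hx => (hVo x hx).mem_nhds (hxV x hx)
  have hcenter : ∀ i : Fin t.card, (t.equivFin.symm i : X) ∈ K := fun i =>
    htK _ (t.equivFin.symm i).2
  obtain ⟨χ, hχ, hsum, -, -⟩ := exists_continuous_sum_one_of_isOpen_isCompact
    (s := fun i : Fin t.card => V (t.equivFin.symm i)) (fun i => hVo _ (hcenter i)) hK
    fun x hx => by
      obtain ⟨y, hy, hxy⟩ := Set.mem_iUnion₂.1 (hcover hx)
      exact Set.mem_iUnion.2 ⟨t.equivFin ⟨y, hy⟩, by simpa using hxy⟩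
  exact ⟨t.card, χ, fun i => ⟨_, hVo _ (hcenter i), hpV _ (hcenter i), hχ i⟩,
    fun x hx => by simpa using hsum hx⟩

section ContinuousDensity

variable {X Y Z : Type*} [MeasurableSpace X] [TopologicalSpace Y]
  [TopologicalSpace Z] [MeasurableSpace Z]

theorem integrable_mul_comp_of_continuousOn [TopologicalSpace X] [OpensMeasurableSpace X]
    {μ : Measure X} [IsFiniteMeasureOnCompacts μ] {P : X → Y} {Ω : Set X} (hΩ : IsOpen Ω)
    (hP : ContinuousOn P Ω) {F : X → ℂ} (hF : Continuous F) (hFc : HasCompactSupport F)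
    (hFΩ : tsupport F ⊆ Ω) {ψ : Y → ℂ} (hψ : Continuous ψ) :
    Integrable (fun x => F x * ψ (P x)) μ := by
  have hsupp : tsupport (fun x => F x * ψ (P x)) ⊆ Ω := tsupport_mul_subset_left.trans hFΩ
  exact ((hF.continuousOn.mul (hψ.comp_continuousOn hP)).continuous_of_tsupport_subset hΩ
    hsupp).integrable_of_hasCompactSupport hFc.mul_right

variable [MeasurableSpace Y]

/-- The image under `P` of the measure with density `F` with respect to `μ` has a continuous
compactly supported density with respect to `ν`, expressed by testing against continuous
functions. -/
def HasContinuousDensity (μ : Measure X) (ν : Measure Y) (P : X → Y) (F : X → ℂ) : Prop :=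
  ∃ h : Y → ℂ, Continuous h ∧ HasCompactSupport h ∧
    ∀ ψ : Y → ℂ, Continuous ψ → ∫ x, F x * ψ (P x) ∂μ = ∫ y, h y * ψ y ∂ν

theorem hasContinuousDensity_sum [R1Space Y] [OpensMeasurableSpace Y] {μ : Measure X}
    {ν : Measure Y} [IsFiniteMeasureOnCompacts ν] {P : X → Y} {ι : Type*} [Fintype ι]
    {F : ι → X → ℂ}
    (hF : ∀ i, HasContinuousDensity μ ν P (F i))
    (hint : ∀ i, ∀ ψ : Y → ℂ, Continuous ψ → Integrable (fun x => F i x * ψ (P x)) μ) :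
    HasContinuousDensity μ ν P fun x => ∑ i, F i x := by
  choose h hh hhc hhi using hF
  refine ⟨fun y => ∑ i, h i y, continuous_finsetSum _ fun i _ => hh i, ?_, fun ψ hψ => ?_⟩
  · refine HasCompactSupport.intro (isCompact_iUnion fun i => (hhc i).isCompact) fun y hy => ?_
    simp only [Set.mem_iUnion, not_exists] at hy
    exact Finset.sum_eq_zero fun i _ => image_eq_zero_of_notMem_tsupport (hy i)
  · simp_rw [Finset.sum_mul]
    have hint' : ∀ i, Integrable (fun y => h i y * ψ y) ν := fun i =>
      ((hh i).mul hψ).integrable_of_hasCompactSupport (hhc i).mul_right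
    rw [integral_finsetSum _ fun i _ => hint i ψ hψ, integral_finsetSum _ fun i _ => hint' i]
    exact Finset.sum_congr rfl fun i _ => hhi i ψ hψ

theorem hasContinuousDensity_fst [T2Space Y] [LocallyCompactSpace Y] [FirstCountableTopology Y]
    [OpensMeasurableSpace (Y × Z)] [OpensMeasurableSpace Z] {ν : Measure Y}
    {κ : Measure Z} [SFinite ν] [SFinite κ] [IsLocallyFiniteMeasure κ]
    [IsFiniteMeasureOnCompacts (ν.prod κ)]
    {F : Y × Z → ℂ} (hF : Continuous F) (hFc : HasCompactSupport F) :
    HasContinuousDensity (ν.prod κ) ν Prod.fst F := by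
  have hFst := hFc.isCompact.image continuous_fst
  have hSnd := hFc.isCompact.image continuous_snd
  have hzero : ∀ y z, (y ∉ Prod.fst '' tsupport F ∨ z ∉ Prod.snd '' tsupport F) → F (y, z) = 0 :=
    fun y z h => image_eq_zero_of_notMem_tsupport fun hyz =>
      h.elim (· ⟨_, hyz, rfl⟩) (· ⟨_, hyz, rfl⟩)
  refine ⟨fun y => ∫ z, F (y, z) ∂κ, ?_, HasCompactSupport.intro hFst fun y hy => ?_,
    fun ψ hψ => ?_⟩
  · have hset : ∀ y, ∫ z, F (y, z) ∂κ = ∫ z in Prod.snd '' tsupport F, F (y, z) ∂κ := fun y =>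
      (setIntegral_eq_integral_of_forall_compl_eq_zero fun z hz => hzero y z (Or.inr hz)).symm
    simp_rw [hset]
    exact continuous_parametric_integral_of_continuous (f := fun y z => F (y, z)) hF hSnd
  · simp [hzero y _ (Or.inl hy)]
  · have hint : Integrable (fun p : Y × Z => F p * ψ p.1) (ν.prod κ) :=
      (hF.mul (hψ.comp continuous_fst)).integrable_of_hasCompactSupport hFc.mul_right
    simp only [integral_prod _ hint, integral_mul_const]

theorem HasContinuousDensity.smul_map {W : Type*} [MeasurableSpace W] {μ : Measure W}
    {ν : Measure Y} {L : W → X} (hL : MeasurableEmbedding L) {P : X → Y} {F : X → ℂ}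
    (h : HasContinuousDensity μ ν (P ∘ L) (F ∘ L)) (c : ℝ≥0) :
    HasContinuousDensity (c • μ.map L) ν P F := by
  obtain ⟨g, hg, hgc, hgi⟩ := h
  refine ⟨fun y => (c : ℂ) * g y, continuous_const.mul hg, hgc.mul_left, fun ψ hψ => ?_⟩
  calc ∫ x, F x * ψ (P x) ∂(c • μ.map L)
      = (c : ℂ) * ∫ w, F (L w) * ψ (P (L w)) ∂μ := by
        rw [integral_smul_nnreal_measure, hL.integral_map, NNReal.smul_def, Complex.real_smul]
    _ = (c : ℂ) * ∫ y, g y * ψ y ∂ν := congrArg _ (hgi ψ hψ)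
    _ = ∫ y, (c : ℂ) * g y * ψ y ∂ν := by simp only [mul_assoc, integral_const_mul]

end ContinuousDensity

section Straightening

variable {X Y : Type*} [NormedAddCommGroup X] [NormedSpace ℝ X] [FiniteDimensional ℝ X]
  [NormedAddCommGroup Y] [NormedSpace ℝ Y] [FiniteDimensional ℝ Y]

theorem exists_openPartialHomeomorph_contDiffOn_symm {T : X → X} {Ω : Set X} (hΩ : IsOpen Ω)
    (hT : ContDiffOn ℝ 1 T Ω) {x : X} (hx : x ∈ Ω)
    (hd : HasFDerivAt T (ContinuousLinearMap.id ℝ X) x) :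
    ∃ e : OpenPartialHomeomorph X X, ⇑e = T ∧ x ∈ e.source ∧ e.source ⊆ Ω ∧
      ContDiffOn ℝ 1 e.symm e.target := by
  have : CompleteSpace X := FiniteDimensional.complete ℝ X
  have hTx := hT.contDiffAt (hΩ.mem_nhds hx)
  have hd' : HasFDerivAt T ((ContinuousLinearEquiv.refl ℝ X : X ≃L[ℝ] X) : X →L[ℝ] X) x := hd
  let O : Set X := Ω ∩ fderiv ℝ T ⁻¹' Set.range ((↑) : (X ≃L[ℝ] X) → X →L[ℝ] X)
  have hO : IsOpen O := (hT.continuousOn_fderiv_of_isOpen hΩ le_rfl).isOpen_inter_preimage hΩ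
    ContinuousLinearEquiv.isOpen
  let e := (hTx.toOpenPartialHomeomorph T hd' one_ne_zero).restrOpen O hO
  have hxe : x ∈ e.source := ⟨hTx.mem_toOpenPartialHomeomorph_source hd' one_ne_zero, hx,
    ContinuousLinearEquiv.refl ℝ X, hd'.fderiv.symm⟩
  refine ⟨e, rfl, hxe, fun y hy => hy.2.1, fun w hw => ?_⟩
  obtain ⟨hyΩ, f', hf'⟩ := (e.map_target hw).2
  have hTy : ContDiffAt ℝ 1 T (e.symm w) := hT.contDiffAt (hΩ.mem_nhds hyΩ)
  refine (e.contDiffAt_symm (f₀' := f') hw ?_ hTy).contDiffWithinAt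
  rw [hf']
  exact (hTy.differentiableAt one_ne_zero).hasFDerivAt

theorem exists_openPartialHomeomorph_comp_fderiv_eq {P : X → Y} {Ω : Set X} (hΩ : IsOpen Ω)
    (hP : ContDiffOn ℝ 1 P Ω) {x : X} (hx : x ∈ Ω) (hsurj : Function.Surjective (fderiv ℝ P x)) :
    ∃ e : OpenPartialHomeomorph X X, x ∈ e.source ∧ e.source ⊆ Ω ∧ ContDiffOn ℝ 1 e e.source ∧
      ContDiffOn ℝ 1 e.symm e.target ∧ ∀ z, fderiv ℝ P x (e z) = P z := by
  set A := fderiv ℝ P x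
  obtain ⟨R, hAR⟩ := A.exists_rightInverse_of_surjective (LinearMap.range_eq_top.2 hsurj)
  -- Correcting `z` along the range of the right inverse `R` has derivative `id` at `x`.
  let T : X → X := fun z => z + R (P z - A z)
  have hT : ContDiffOn ℝ 1 T Ω :=
    contDiffOn_id.add (R.contDiff.comp_contDiffOn (hP.sub A.contDiff.contDiffOn))
  have hTd : HasFDerivAt T (ContinuousLinearMap.id ℝ X) x := by
    have hPx : HasFDerivAt P A x :=
      ((hP.contDiffAt (hΩ.mem_nhds hx)).differentiableAt one_ne_zero).hasFDerivAt
    have := (hasFDerivAt_id x).add (R.hasFDerivAt.comp x (hPx.sub A.hasFDerivAt))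
    rwa [sub_self, ContinuousLinearMap.comp_zero, add_zero] at this
  obtain ⟨e, heT, hxe, heΩ, hes⟩ := exists_openPartialHomeomorph_contDiffOn_symm hΩ hT hx hTd
  refine ⟨e, hxe, heΩ, heT ▸ hT.mono heΩ, hes, fun z => ?_⟩
  have hARz : A (R (P z - A z)) = P z - A z := DFunLike.congr_fun hAR _
  rw [heT, map_add, hARz, add_sub_cancel]

variable [MeasurableSpace X] [BorelSpace X] [MeasurableSpace Y] [BorelSpace Y]
  (μ : Measure X) [μ.IsAddHaarMeasure] (ν : Measure Y) [ν.IsAddHaarMeasure]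

theorem exists_integral_mul_comp_openPartialHomeomorph {e : OpenPartialHomeomorph X X}
    (he : ContDiffOn ℝ 1 e.symm e.target) {F : X → ℂ} (hF : Continuous F)
    (hFc : HasCompactSupport F) (hFe : tsupport F ⊆ e.source) :
    ∃ H : X → ℂ, Continuous H ∧ HasCompactSupport H ∧
      ∀ q : X → ℂ, ∫ x, F x * q (e x) ∂μ = ∫ w, H w * q w ∂μ := by
  classical
  let J : X → ℂ := fun w => |(fderiv ℝ e.symm w).det| • F (e.symm w)
  have hK : IsCompact (e '' tsupport F) :=
    hFc.isCompact.image_of_continuousOn (e.continuousOn.mono hFe)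
  have hKe : e '' tsupport F ⊆ e.target := Set.image_subset_iff.2 fun x hx =>
    e.map_source (hFe hx)
  have hzero : ∀ w ∉ e '' tsupport F, e.target.indicator J w = 0 := fun w hw =>
    Set.indicator_apply_eq_zero.2 fun hwe => by
      have : F (e.symm w) = 0 := image_eq_zero_of_notMem_tsupport fun hF =>
        hw ⟨e.symm w, hF, e.right_inv hwe⟩
      simp only [J, this, smul_zero]
  have hJ : ContinuousOn J e.target :=
    (ContinuousLinearMap.continuous_det.comp_continuousOn
      (he.continuousOn_fderiv_of_isOpen e.open_target le_rfl)).abs.smul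
      (hF.comp_continuousOn e.symm.continuousOn)
  refine ⟨e.target.indicator J, ?_, HasCompactSupport.intro hK hzero, fun q => ?_⟩
  · exact (hJ.congr fun w hw => Set.indicator_of_mem hw _).continuous_of_tsupport_subset
      e.open_target ((tsupport_subset_of_eq_zero_off hK.isClosed hzero).trans hKe)
  have hcov := integral_target_eq_integral_abs_det_fderiv_smul μ (f := e.symm)
    (f' := fderiv ℝ e.symm) (fun w hw => ((he.contDiffAt
      (e.open_target.mem_nhds hw)).differentiableAt one_ne_zero).hasFDerivAt)
    fun x => F x * q (e x)
  simp only [OpenPartialHomeomorph.symm_target, OpenPartialHomeomorph.symm_source] at hcov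
  rw [← setIntegral_eq_integral_of_forall_compl_eq_zero (s := e.source) (fun x hx => by
      rw [image_eq_zero_of_notMem_tsupport fun h => hx (hFe h), zero_mul]), hcov,
    ← integral_indicator e.open_target.measurableSet]
  congr 1 with w
  by_cases hw : w ∈ e.target
  · simp only [Set.indicator_of_mem hw, J, e.right_inv hw, smul_mul_assoc]
  · simp only [Set.indicator_of_notMem hw, zero_mul]

theorem hasContinuousDensity_of_surjective {A : X →L[ℝ] Y} (hA : Function.Surjective A)
    {F : X → ℂ} (hF : Continuous F) (hFc : HasCompactSupport F) :
    HasContinuousDensity μ ν A F := by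
  obtain ⟨R, hAR⟩ := A.exists_rightInverse_of_surjective (LinearMap.range_eq_top.2 hA)
  obtain ⟨L, hL⟩ : ∃ L : X ≃L[ℝ] Y × A.ker, ∀ x, (L x).1 = A x :=
    ⟨ContinuousLinearEquiv.equivOfRightInverse A R (DFunLike.congr_fun hAR), fun _ => rfl⟩
  have hm : ((ν.prod Measure.addHaar).map L.symm).IsAddHaarMeasure :=
    L.symm.isAddHaarMeasure_map _
  obtain ⟨c, hμ⟩ : ∃ c : ℝ≥0, μ = c • (ν.prod Measure.addHaar).map L.symm :=
    ⟨_, Measure.isAddLeftInvariant_eq_smul _ _⟩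
  rw [hμ]
  refine HasContinuousDensity.smul_map L.symm.toHomeomorph.measurableEmbedding ?_ c
  have hAL : A ∘ L.symm = Prod.fst := funext fun p => by
    rw [Function.comp_apply, ← hL, L.apply_symm_apply]
  rw [ContinuousLinearEquiv.coe_toHomeomorph, hAL]
  exact hasContinuousDensity_fst (hF.comp L.symm.continuous)
    (hFc.comp_homeomorph L.symm.toHomeomorph)

theorem hasContinuousDensity_of_submersion {P : X → Y} {Ω : Set X} (hΩ : IsOpen Ω)
    (hP : ContDiffOn ℝ 1 P Ω) (hsurj : ∀ x ∈ Ω, Function.Surjective (fderiv ℝ P x)) {F : X → ℂ}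
    (hF : Continuous F) (hFc : HasCompactSupport F) (hFΩ : tsupport F ⊆ Ω) :
    HasContinuousDensity μ ν P F := by
  have hlocal : ∀ x ∈ tsupport F, ∃ V, IsOpen V ∧ x ∈ V ∧ (V ⊆ Ω ∧ ∀ F : X → ℂ, Continuous F →
      HasCompactSupport F → tsupport F ⊆ V → HasContinuousDensity μ ν P F) := by
    intro x hx
    obtain ⟨e, hxe, heΩ, -, hes, heP⟩ :=
      exists_openPartialHomeomorph_comp_fderiv_eq hΩ hP (hFΩ hx) (hsurj x (hFΩ hx))
    refine ⟨e.source, e.open_source, hxe, heΩ, fun F hF hFc hFe => ?_⟩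
    obtain ⟨H, hH, hHc, hHi⟩ := exists_integral_mul_comp_openPartialHomeomorph μ hes hF hFc hFe
    obtain ⟨h, hh, hhc, hhi⟩ := hasContinuousDensity_of_surjective μ ν (hsurj x (hFΩ hx)) hH hHc
    refine ⟨h, hh, hhc, fun ψ hψ => ?_⟩
    rw [← hhi ψ hψ, ← hHi fun w => ψ (fderiv ℝ P x w)]
    simp only [heP]
  obtain ⟨n, χ, hχ, hsum⟩ := exists_partition_of_unity_of_isCompact hFc.isCompact hlocal
  choose V _ hV hχV using hχ
  have hsplit : F = fun x => ∑ i, (χ i x : ℂ) * F x := by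
    ext x
    rw [← Finset.sum_mul]
    by_cases hx : x ∈ tsupport F
    · rw [← Complex.ofReal_sum, hsum x hx, Complex.ofReal_one, one_mul]
    · rw [image_eq_zero_of_notMem_tsupport hx, mul_zero]
  have hcont : ∀ i, Continuous fun x => (χ i x : ℂ) * F x := fun i =>
    (Complex.continuous_ofReal.comp (χ i).continuous).mul hF
  have hsupp : ∀ i, tsupport (fun x => (χ i x : ℂ) * F x) ⊆ V i := fun i =>
    tsupport_mul_subset_left.trans ((tsupport_comp_subset Complex.ofReal_zero _).trans (hχV i))
  rw [hsplit]
  exact hasContinuousDensity_sum (fun i => (hV i).2 _ (hcont i) hFc.mul_left (hsupp i))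
    fun i ψ hψ => integrable_mul_comp_of_continuousOn hΩ hP.continuousOn (hcont i) hFc.mul_left
      ((hsupp i).trans (hV i).1) hψ

end Straightening

/-! ### Surface pieces and their area -/

section Projection

variable {E : Type*} [NormedAddCommGroup E] [InnerProductSpace ℝ E] {d : ℕ}

theorem exists_linearIsometry_range_eq_orthogonal (hd : Module.finrank ℝ E = d + 1) {v : E}
    (hv : v ≠ 0) :
    ∃ ι : EuclideanSpace ℝ (Fin d) →ₗᵢ[ℝ] E, Set.range ι = {x | inner ℝ v x = 0} := by
  have : Fact (Module.finrank ℝ E = d + 1) := ⟨hd⟩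
  let B := OrthonormalBasis.fromOrthogonalSpanSingleton (𝕜 := ℝ) d hv
  refine ⟨(Submodule.subtypeₗᵢ _).comp B.repr.symm.toLinearIsometry, Set.ext fun x => ?_⟩
  rw [Set.mem_ofPred_eq, ← Submodule.mem_orthogonal_singleton_iff_inner_right (𝕜 := ℝ)]
  exact ⟨fun ⟨u, hu⟩ => hu ▸ (B.repr.symm u).2, fun hx => ⟨B.repr ⟨x, hx⟩, by simp⟩⟩

theorem exists_projection_norm_le (hd : Module.finrank ℝ E = d + 1) {v : E} (hv : ‖v‖ = 1) :
    ∃ p : E →L[ℝ] EuclideanSpace ℝ (Fin d), ‖p‖ ≤ 1 ∧ ∀ x, ‖x‖ ≤ ‖p x‖ + |inner ℝ v x| := by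
  have : FiniteDimensional ℝ E := Module.finite_of_finrank_pos (hd ▸ d.succ_pos)
  have hv0 : v ≠ 0 := norm_ne_zero_iff.1 (hv ▸ one_ne_zero)
  obtain ⟨ι, hι⟩ := exists_linearIsometry_range_eq_orthogonal hd hv0
  have hιv : ∀ w, inner ℝ v (ι w) = 0 := fun w => hι.subset ⟨w, rfl⟩
  let p := ContinuousLinearMap.adjoint ι.toContinuousLinearMap
  refine ⟨p, ?_, fun x => ?_⟩
  · rw [LinearIsometryEquiv.norm_map]
    exact ι.norm_toContinuousLinearMap_le
  have hmem : inner ℝ v (x - inner ℝ v x • v) = 0 := by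
    rw [inner_sub_right, inner_smul_right, real_inner_self_eq_norm_sq, hv, one_pow, mul_one,
      sub_self]
  obtain ⟨u, hu⟩ := hι.superset hmem
  have hx : x = ι u + inner ℝ v x • v := by rw [hu, sub_add_cancel]
  have hpx : p x = u := ext_inner_right ℝ fun w => by
    rw [ContinuousLinearMap.adjoint_inner_left, LinearIsometry.coe_toContinuousLinearMap, hx,
      inner_add_left, inner_smul_left, hιv, mul_zero, add_zero, ι.inner_map_map]
  calc ‖x‖ = ‖ι u + inner ℝ v x • v‖ := by rw [← hx]
    _ ≤ ‖ι u‖ + ‖inner ℝ v x • v‖ := norm_add_le _ _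
    _ = ‖p x‖ + |inner ℝ v x| := by
      rw [ι.norm_map, norm_smul, hv, mul_one, Real.norm_eq_abs, hpx]

theorem euclideanHausdorffMeasure_le_of_norm_le_projection [MeasurableSpace E] [BorelSpace E]
    {p : E →L[ℝ] EuclideanSpace ℝ (Fin d)} (hp : ‖p‖ ≤ 1) {B : Set E} {K : ℝ≥0} {r : ℝ}
    (hB : ∀ x ∈ B, ∀ y ∈ B, ‖x - y‖ ≤ K * ‖p (x - y)‖)
    (hr : ∀ x ∈ B, ∀ y ∈ B, ‖x - y‖ ≤ r) :
    μHE[d] B ≤ (K : ℝ≥0∞) ^ d *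
      (ENNReal.ofReal r ^ d * volume (Metric.ball (0 : EuclideanSpace ℝ (Fin d)) 1)) := by
  rcases B.eq_empty_or_nonempty with rfl | ⟨σ, hσ⟩
  · simp
  have hr0 : 0 ≤ r := (norm_nonneg _).trans (hr σ hσ σ hσ)
  have hsub : p '' B ⊆ Metric.closedBall (p σ) r := by
    rintro _ ⟨x, hx, rfl⟩
    rw [mem_closedBall_iff_norm, ← map_sub]
    exact (p.le_of_opNorm_le hp _).trans ((one_mul _).trans_le (hr x hx σ hσ))
  calc μHE[d] B = μHE[d] (id '' B) := by rw [Set.image_id]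
    _ ≤ (K : ℝ≥0∞) ^ d * μHE[d] (p '' B) :=
      euclideanHausdorffMeasure_image_le_of_dist_le d fun x hx y hy => by
        simpa only [dist_eq_norm, id, map_sub] using hB x hx y hy
    _ ≤ (K : ℝ≥0∞) ^ d * volume (Metric.closedBall (p σ) r) := by
      rw [EuclideanSpace.euclideanHausdorffMeasure_eq_volume]
      gcongr
    _ = _ := by
      rw [Measure.addHaar_closedBall _ _ hr0, finrank_euclideanSpace_fin, ENNReal.ofReal_pow hr0]

end Projection

theorem measurableSet_of_isLocallyClosed {X : Type*} [TopologicalSpace X] [MeasurableSpace X]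
    [OpensMeasurableSpace X] {S : Set X} (h : IsLocallyClosed S) : MeasurableSet S := by
  obtain ⟨u, z, hu, hz, rfl⟩ := h
  exact hu.measurableSet.inter hz.measurableSet

theorem exists_mul_rpow_le {β : ℝ} (hβ : 0 < β) (c : ℝ) {a : ℝ} (ha : 0 < a) :
    ∃ r : ℝ, 0 < r ∧ ∀ t, 0 ≤ t → t ≤ r → c * t ^ β ≤ a := by
  have hcont : ContinuousAt (fun t : ℝ => c * t ^ β) 0 :=
    continuousAt_const.mul (Real.continuousAt_rpow_const _ _ (Or.inr hβ.le))
  have hzero : c * (0 : ℝ) ^ β < a := by rwa [Real.zero_rpow hβ.ne', mul_zero]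
  obtain ⟨r, hr, hball⟩ := Metric.eventually_nhds_iff_ball.1 (hcont.eventually (gt_mem_nhds hzero))
  refine ⟨r / 2, half_pos hr, fun t ht htr => (hball t ?_).le⟩
  rw [Metric.mem_ball, Real.dist_0_eq_abs, abs_of_nonneg ht]
  linarith

section SurfacePiece

theorem gradient_eq_zero_iff {F : Type*} [NormedAddCommGroup F] [InnerProductSpace ℝ F]
    [CompleteSpace F] {Φ : F → ℝ} {x : F} : gradient Φ x = 0 ↔ fderiv ℝ Φ x = 0 := by
  rw [← toDual_gradient, map_eq_zero_iff _ (LinearIsometryEquiv.injective _)]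

variable {β : ℝ≥0} {b : ℝ} {S U : Set E3} {Φ : E3 → ℝ} {n : E3 → E3}

theorem isOpen_inter_gradient_ne_zero (hU : IsOpen U) (hΦ : ContDiffOn ℝ 1 Φ U) :
    IsOpen (U ∩ {x | gradient Φ x ≠ 0}) := by
  simp only [ne_eq, gradient_eq_zero_iff]
  exact (hΦ.continuousOn_fderiv_of_isOpen hU le_rfl).isOpen_inter_preimage hU
    isOpen_compl_singleton

theorem isLocallyClosed_levelSurface (hU : IsOpen U) (hΦ : ContDiffOn ℝ 1 Φ U) :
    IsLocallyClosed (levelSurface U Φ) := by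
  obtain ⟨Z, hZ, hZU⟩ := continuousOn_iff_isClosed.1 hΦ.continuousOn {0} isClosed_singleton
  refine ⟨U ∩ {x | gradient Φ x ≠ 0}, Z, isOpen_inter_gradient_ne_zero hU hΦ, hZ, ?_⟩
  ext x
  have := Set.ext_iff.1 hZU x
  simp only [levelSurface, Set.mem_inter_iff, Set.mem_preimage, Set.mem_singleton_iff,
    Set.mem_ofPred_eq] at this ⊢
  tauto

theorem IsSurfacePiece.isLocallyClosed (h : IsSurfacePiece β b S U Φ n) : IsLocallyClosed S := by
  obtain ⟨V, hV, rfl⟩ := h.relOpen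
  exact (isLocallyClosed_levelSurface h.isOpen_U h.regular.1).inter hV.isLocallyClosed

theorem IsSurfacePiece.measurableSet (h : IsSurfacePiece β b S U Φ n) : MeasurableSet S :=
  measurableSet_of_isLocallyClosed h.isLocallyClosed

theorem IsSurfacePiece.subset_levelSurface (h : IsSurfacePiece β b S U Φ n) :
    S ⊆ levelSurface U Φ := by
  obtain ⟨V, -, rfl⟩ := h.relOpen
  exact Set.inter_subset_left

theorem IsSurfacePiece.norm_normal_sub_le (h : IsSurfacePiece β b S U Φ n) (hβ : 0 < β) {σ τ : E3}
    (hσ : σ ∈ S) (hτ : τ ∈ S) : ‖n σ - n τ‖ ≤ b * ‖σ - τ‖ ^ (β : ℝ) := by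
  rcases eq_or_ne σ τ with rfl | hne
  · simp [NNReal.coe_ne_zero.2 hβ.ne']
  have hpos : 0 < ‖σ - τ‖ := norm_pos_iff.2 (sub_ne_zero.2 hne)
  exact (div_le_iff₀ (by positivity)).1 (le_of_add_le_of_nonneg_left
    (h.holder σ (h.subset_levelSurface hσ) τ (h.subset_levelSurface hτ) hne) (by positivity))

theorem IsSurfacePiece.abs_inner_normal_sub_le (h : IsSurfacePiece β b S U Φ n) {σ τ : E3}
    (hσ : σ ∈ S) (hτ : τ ∈ S) :
    |inner ℝ (n σ) (σ - τ)| ≤ b * ‖σ - τ‖ ^ (β : ℝ) * ‖σ - τ‖ := by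
  rcases eq_or_ne σ τ with rfl | hne
  · simp
  have hpos : 0 < ‖σ - τ‖ := norm_pos_iff.2 (sub_ne_zero.2 hne)
  rw [mul_assoc, ← Real.rpow_add_one hpos.ne', add_comm]
  exact (div_le_iff₀ (by positivity)).1 (le_of_add_le_of_nonneg_right
    (h.holder σ (h.subset_levelSurface hσ) τ (h.subset_levelSurface hτ) hne) (by positivity))

theorem IsSurfacePiece.abs_inner_normal_le (h : IsSurfacePiece β b S U Φ n) (hβ : 0 < β) {a R : ℝ}
    (hR : ∀ t, 0 ≤ t → t ≤ R → b * t ^ (β : ℝ) ≤ a) {σ x y : E3} (hσ : σ ∈ S) (hx : x ∈ S)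
    (hy : y ∈ S) (hσx : ‖σ - x‖ ≤ R) (hxy : ‖x - y‖ ≤ R) :
    |inner ℝ (n σ) (x - y)| ≤ 2 * a * ‖x - y‖ := by
  have htilt : ‖n σ - n x‖ ≤ a := (h.norm_normal_sub_le hβ hσ hx).trans (hR _ (norm_nonneg _) hσx)
  have hflat : b * ‖x - y‖ ^ (β : ℝ) ≤ a := hR _ (norm_nonneg _) hxy
  calc |inner ℝ (n σ) (x - y)| = |inner ℝ (n σ - n x) (x - y) + inner ℝ (n x) (x - y)| := by
        rw [← inner_add_left, sub_add_cancel]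
    _ ≤ |inner ℝ (n σ - n x) (x - y)| + |inner ℝ (n x) (x - y)| := abs_add_le _ _
    _ ≤ ‖n σ - n x‖ * ‖x - y‖ + b * ‖x - y‖ ^ (β : ℝ) * ‖x - y‖ :=
      add_le_add (abs_real_inner_le_norm _ _) (h.abs_inner_normal_sub_le hx hy)
    _ ≤ a * ‖x - y‖ + a * ‖x - y‖ := by gcongr
    _ = 2 * a * ‖x - y‖ := by ring

theorem exists_surfaceMeasure_closedBall_le (hβ : 0 < β) (b : ℝ) :
    ∃ r₀ : ℝ, 0 < r₀ ∧ ∃ M : ℝ≥0, ∀ (S U : Set E3) (Φ : E3 → ℝ) (n : E3 → E3),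
      IsSurfacePiece β b S U Φ n → ∀ (p : E3) (r : ℝ), r ≤ r₀ →
        surfaceMeasure S (Metric.closedBall p r) ≤ M * ENNReal.ofReal r ^ 2 := by
  obtain ⟨R, hR, hRβ⟩ := exists_mul_rpow_le (NNReal.coe_pos.2 hβ) b (a := 1 / 4) (by norm_num)
  have hfin : volume (Metric.ball (0 : EuclideanSpace ℝ (Fin 2)) 1) ≠ ⊤ := measure_ball_lt_top.ne
  refine ⟨R / 2, half_pos hR,
    16 * (volume (Metric.ball (0 : EuclideanSpace ℝ (Fin 2)) 1)).toNNReal,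
    fun S U Φ n h p r hrR => ?_⟩
  rw [surfaceMeasure, Measure.restrict_apply measurableSet_closedBall]
  rcases (Metric.closedBall p r ∩ S).eq_empty_or_nonempty with he | ⟨σ, hσ⟩
  · simp [he]
  have hdist : ∀ x ∈ Metric.closedBall p r ∩ S, ∀ y ∈ Metric.closedBall p r ∩ S,
      ‖x - y‖ ≤ 2 * r := fun x hx y hy => by
    rw [← dist_eq_norm, two_mul]
    exact (dist_triangle_right x y p).trans (add_le_add hx.1 hy.1)
  obtain ⟨π, hπ1, hπ⟩ := exists_projection_norm_le (d := 2) finrank_euclideanSpace_fin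
    (h.norm_normal σ (h.subset_levelSurface hσ.2))
  -- On so small a piece the normal component of a chord is at most half its length.
  have hproj : ∀ x ∈ Metric.closedBall p r ∩ S, ∀ y ∈ Metric.closedBall p r ∩ S,
      ‖x - y‖ ≤ (2 : ℝ≥0) * ‖π (x - y)‖ := fun x hx y hy => by
    have := h.abs_inner_normal_le hβ hRβ hσ.2 hx.2 hy.2 ((hdist σ hσ x hx).trans (by linarith))
      ((hdist x hx y hy).trans (by linarith))
    have := hπ (x - y)
    rw [NNReal.coe_ofNat]
    linarith
  refine (euclideanHausdorffMeasure_le_of_norm_le_projection hπ1 hproj hdist).trans_eq ?_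
  rw [ENNReal.coe_mul, ENNReal.coe_toNNReal hfin, ENNReal.ofReal_mul zero_le_two]
  simp only [ENNReal.ofReal_ofNat, ENNReal.coe_ofNat]
  ring

theorem IsSurfacePiece.isFiniteMeasure (hβ : 0 < β) (h : IsSurfacePiece β b S U Φ n) :
    IsFiniteMeasure (surfaceMeasure S) := by
  obtain ⟨r, hr, M, hM⟩ := exists_surfaceMeasure_closedBall_le hβ b
  have htb : TotallyBounded S :=
    (Bornology.IsBounded.isCompact_closure h.bounded).totallyBounded.subset subset_closure
  obtain ⟨t, htf, hcov⟩ := Metric.totallyBounded_iff.1 htb r hr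
  have hball : ∀ p, surfaceMeasure S (Metric.ball p r) < ⊤ := fun p =>
    (measure_mono Metric.ball_subset_closedBall).trans_lt
      ((hM S U Φ n h p r le_rfl).trans_lt
        (ENNReal.mul_lt_top ENNReal.coe_lt_top (ENNReal.pow_lt_top ENNReal.ofReal_lt_top)))
  refine ⟨?_⟩
  rw [surfaceMeasure, Measure.restrict_apply_univ, ← Measure.restrict_apply_self]
  exact (measure_mono hcov).trans_lt (measure_biUnion_lt_top htf fun p _ => hball p)

end SurfacePiece

/-! ### Charts of hypersurfaces -/

section Slice

variable {V E : Type*} [NormedAddCommGroup V] [InnerProductSpace ℝ V] [NormedAddCommGroup E]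
  [InnerProductSpace ℝ E] {e : OpenPartialHomeomorph E E} (ι : V →ₗᵢ[ℝ] E)

theorem isInjImmersionOn_symm_comp (he : ContDiffOn ℝ 1 e e.source)
    (hes : ContDiffOn ℝ 1 e.symm e.target) : IsInjImmersionOn (e.symm ∘ ι) (ι ⁻¹' e.target) := by
  have hΩ : IsOpen (ι ⁻¹' e.target) := e.open_target.preimage ι.continuous
  have hG : ContDiffOn ℝ 1 (e.symm ∘ ι) (ι ⁻¹' e.target) :=
    hes.comp ι.toContinuousLinearMap.contDiff.contDiffOn fun _ hu => hu
  have heG : ∀ u ∈ ι ⁻¹' e.target, e (e.symm (ι u)) = ι u := fun _ hu => e.right_inv hu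
  refine ⟨hΩ, hG, fun u hu v hv huv => ι.injective ?_, fun u hu => ?_⟩
  · rw [← heG u hu, ← heG v hv]
    exact congrArg e huv
  have hchain := ((he.differentiableOn one_ne_zero).hasFDerivAt
    (e.open_source.mem_nhds (e.map_target hu))).comp u
      ((hG.differentiableOn one_ne_zero).hasFDerivAt (hΩ.mem_nhds hu))
  have hι : HasFDerivAt (e ∘ (e.symm ∘ ι)) ι.toContinuousLinearMap u :=
    ι.toContinuousLinearMap.hasFDerivAt.congr_of_eventuallyEq
      (eventually_of_mem (hΩ.mem_nhds hu) heG)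
  have hinj : Function.Injective (fderiv ℝ e (e.symm (ι u)) ∘ fderiv ℝ (e.symm ∘ ι) u) := by
    rw [← ContinuousLinearMap.coe_comp, hchain.unique hι]
    exact ι.injective
  exact hinj.of_comp

theorem image_symm_comp_preimage_target :
    (e.symm ∘ ι) '' (ι ⁻¹' e.target) = e.source ∩ e ⁻¹' Set.range ι := by
  rw [Set.image_comp, Set.image_preimage_eq_inter_range, e.symm_image_target_inter_eq]
  exact Set.ext fun x => ⟨fun h => ⟨h.1, h.2.2⟩, fun h => ⟨h.1, e.map_source h.1, h.2⟩⟩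

theorem isCompact_preimage_symm_comp [CompleteSpace V] {K : Set E} (hK : IsCompact K)
    (hKe : K ⊆ e.source) : IsCompact (ι ⁻¹' e.target ∩ (e.symm ∘ ι) ⁻¹' K) := by
  rw [Set.preimage_comp, ← Set.preimage_inter, ← e.image_eq_target_inter_inv_preimage hKe]
  exact ι.isometry.isClosedEmbedding.isCompact_preimage
    (hK.image_of_continuousOn (e.continuousOn.mono hKe))

end Slice

section Chart

variable {E : Type*} [NormedAddCommGroup E] [InnerProductSpace ℝ E] {d : ℕ}

/-- `G : Ω → E` is a proper `C¹` parametrisation of the part of the hypersurface `S` in `O`, and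
`n` is normal to `S` there. -/
structure IsSurfaceChart (S : Set E) (n : E → E) (O : Set E) (Ω : Set (EuclideanSpace ℝ (Fin d)))
    (G : EuclideanSpace ℝ (Fin d) → E) : Prop where
  isInjImmersionOn : IsInjImmersionOn G Ω
  image_eq : G '' Ω = S ∩ O
  inner_normal_fderiv : ∀ u ∈ Ω, ∀ a, inner ℝ (n (G u)) (fderiv ℝ G u a) = 0
  isCompact_preimage : ∀ K ⊆ S ∩ O, IsCompact K → IsCompact (Ω ∩ G ⁻¹' K)

variable {S O : Set E} {n : E → E} {Ω : Set (EuclideanSpace ℝ (Fin d))}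
  {G : EuclideanSpace ℝ (Fin d) → E}

theorem IsSurfaceChart.mem (h : IsSurfaceChart S n O Ω G) {u : EuclideanSpace ℝ (Fin d)}
    (hu : u ∈ Ω) : G u ∈ S :=
  (h.image_eq.subset ⟨u, hu, rfl⟩).1

theorem IsSurfaceChart.exists_pullback [CompleteSpace E] [MeasurableSpace E] [BorelSpace E]
    (h : IsSurfaceChart S n O Ω G) (hO : IsOpen O) {f : E → ℂ} (hf : ContinuousOn f S) {K : Set E}
    (hK : IsCompact K) (hKS : K ⊆ S ∩ O) (hfK : ∀ x ∉ K, f x = 0) :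
    ∃ F : EuclideanSpace ℝ (Fin d) → ℂ, Continuous F ∧ HasCompactSupport F ∧ tsupport F ⊆ Ω ∧
      ∀ q : E → ℂ, ∫ x in S, f x * q x ∂μHE[d] = ∫ u, F u * q (G u) := by
  classical
  obtain ⟨hG, himg, -, hprop⟩ := h
  let J : EuclideanSpace ℝ (Fin d) → ℂ := fun u =>
    (fderiv ℝ G u : EuclideanSpace ℝ (Fin d) →ₗ[ℝ] E).normDet • f (G u)
  have hJ : ContinuousOn J Ω := hG.continuousOn_normDet.smul
    (hf.comp hG.contDiffOn.continuousOn fun u hu => (himg.subset ⟨u, hu, rfl⟩).1)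
  have hzero : ∀ u ∉ Ω ∩ G ⁻¹' K, Ω.indicator J u = 0 := fun u hu =>
    Set.indicator_apply_eq_zero.2 fun huΩ => by
      simp only [J, hfK _ fun hGu => hu ⟨huΩ, hGu⟩, smul_zero]
  have hsupp : tsupport (Ω.indicator J) ⊆ Ω :=
    (tsupport_subset_of_eq_zero_off (hprop K hKS hK).isClosed hzero).trans Set.inter_subset_left
  refine ⟨Ω.indicator J, (hJ.congr fun u hu => Set.indicator_of_mem hu _
    ).continuous_of_tsupport_subset hG.isOpen hsupp, HasCompactSupport.intro (hprop K hKS hK) hzero,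
    hsupp, fun q => ?_⟩
  have harea := hG.setIntegral_image fun x => f x * q x
  rw [finrank_euclideanSpace_fin, himg] at harea
  rw [← setIntegral_eq_integral_of_forall_compl_eq_zero (s := O) (fun x hx => by
      rw [hfK x fun h => hx (hKS h).2, zero_mul]), Measure.restrict_restrict hO.measurableSet,
    Set.inter_comm, harea, ← integral_indicator hG.isOpen.measurableSet]
  congr 1 with u
  by_cases hu : u ∈ Ω
  · simp only [Set.indicator_of_mem hu, J, smul_mul_assoc]
  · simp only [Set.indicator_of_notMem hu, zero_mul]

end Chart

theorem exists_isSurfaceChart_levelSurface {U V : Set E3} {Φ : E3 → ℝ} (hU : IsOpen U)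
    (hΦ : ContDiffOn ℝ 1 Φ U) (hV : IsOpen V) {n : E3 → E3}
    (hn : ∀ x ∈ levelSurface U Φ, ∃ c : ℝ, n x = c • gradient Φ x) {σ : E3}
    (hσ : σ ∈ levelSurface U Φ ∩ V) :
    ∃ O, IsOpen O ∧ σ ∈ O ∧ ∃ (Ω : Set (EuclideanSpace ℝ (Fin 2))) (G : _ → E3),
      IsSurfaceChart (levelSurface U Φ ∩ V) n O Ω G := by
  have hD : IsOpen (U ∩ {x | gradient Φ x ≠ 0} ∩ V) :=
    (isOpen_inter_gradient_ne_zero hU hΦ).inter hV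
  have hDΦ : ContDiffOn ℝ 1 Φ (U ∩ {x | gradient Φ x ≠ 0} ∩ V) := hΦ.mono fun x hx => hx.1.1
  have hsurj : Function.Surjective (fderiv ℝ Φ σ) :=
    LinearMap.surjective (f := (fderiv ℝ Φ σ : E3 →ₗ[ℝ] ℝ)) fun h =>
      hσ.1.2.2 (gradient_eq_zero_iff.2 (ContinuousLinearMap.coe_injective h))
  obtain ⟨e, hσe, heD, he, hes, heΦ⟩ :=
    exists_openPartialHomeomorph_comp_fderiv_eq hD hDΦ ⟨⟨hσ.1.1, hσ.1.2.2⟩, hσ.2⟩ hsurj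
  obtain ⟨ι, hι⟩ := exists_linearIsometry_range_eq_orthogonal (d := 2) finrank_euclideanSpace_fin
    hσ.1.2.2
  simp only [inner_gradient_left] at hι
  have hG := isInjImmersionOn_symm_comp ι he hes
  have himage : (e.symm ∘ ι) '' (ι ⁻¹' e.target) = levelSurface U Φ ∩ V ∩ e.source := by
    rw [image_symm_comp_preimage_target, hι]
    ext x
    simp only [Set.mem_inter_iff, Set.mem_preimage, Set.mem_ofPred_eq, heΦ]
    exact ⟨fun h => ⟨⟨⟨(heD h.1).1.1, h.2, (heD h.1).1.2⟩, (heD h.1).2⟩, h.1⟩,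
      fun h => ⟨h.2, h.1.1.2.1⟩⟩
  have hlevel : ∀ u ∈ ι ⁻¹' e.target, e.symm (ι u) ∈ levelSurface U Φ := fun u hu =>
    (himage.subset ⟨u, hu, rfl⟩).1.1
  refine ⟨e.source, e.open_source, hσe, _, _, hG, himage, fun u hu a => ?_,
    fun K hK hKc => isCompact_preimage_symm_comp ι hKc fun x hx => (hK hx).2⟩
  -- `Φ` vanishes along the chart, so its derivative annihilates the tangent vectors.
  have hchain := ((hΦ.differentiableOn one_ne_zero).hasFDerivAt
    (hU.mem_nhds (hlevel u hu).1)).comp u ((hG.contDiffOn.differentiableOn one_ne_zero).hasFDerivAt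
      (hG.isOpen.mem_nhds hu))
  have hconst : HasFDerivAt (Φ ∘ (e.symm ∘ ι)) (0 : EuclideanSpace ℝ (Fin 2) →L[ℝ] ℝ) u :=
    (hasFDerivAt_const (0 : ℝ) u).congr_of_eventuallyEq
      (eventually_of_mem (hG.isOpen.mem_nhds hu) fun v hv => (hlevel v hv).2.1)
  obtain ⟨c, hc⟩ := hn _ (hlevel u hu)
  rw [Function.comp_apply, hc, inner_smul_left, inner_gradient_left]
  exact mul_eq_zero_of_right _ (DFunLike.congr_fun (hchain.unique hconst) a)

theorem IsSurfacePiece.exists_isSurfaceChart {β : ℝ≥0} {b : ℝ} {S U : Set E3} {Φ : E3 → ℝ}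
    {n : E3 → E3} (h : IsSurfacePiece β b S U Φ n) : ∀ σ ∈ S, ∃ O, IsOpen O ∧ σ ∈ O ∧
      ∃ (Ω : Set (EuclideanSpace ℝ (Fin 2))) (G : _ → E3), IsSurfaceChart S n O Ω G := by
  obtain ⟨V, hV, rfl⟩ := h.relOpen
  exact fun σ => exists_isSurfaceChart_levelSurface h.isOpen_U h.regular.1 hV h.normal_dir

/-! ### Convolution of continuous densities -/

section Transversal

variable {E V₁ V₂ : Type*} [NormedAddCommGroup E] [InnerProductSpace ℝ E] [FiniteDimensional ℝ E]
  [NormedAddCommGroup V₁] [NormedSpace ℝ V₁] [NormedAddCommGroup V₂] [NormedSpace ℝ V₂]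

theorem orthogonal_range_eq_span_singleton {A : V₁ →L[ℝ] E} (hA : Function.Injective A)
    (hd : Module.finrank ℝ E = Module.finrank ℝ V₁ + 1) {v : E} (hv : v ≠ 0)
    (hvA : ∀ a, inner ℝ v (A a) = 0) : (A : V₁ →ₗ[ℝ] E).rangeᗮ = ℝ ∙ v := by
  have hrange : Module.finrank ℝ (A : V₁ →ₗ[ℝ] E).range = Module.finrank ℝ V₁ :=
    LinearMap.finrank_range_of_inj hA
  have hsum := (A : V₁ →ₗ[ℝ] E).range.finrank_add_finrank_orthogonal
  refine (Submodule.eq_of_le_of_finrank_eq ?_ ?_).symm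
  · rw [Submodule.span_singleton_le_iff_mem, Submodule.mem_orthogonal']
    rintro _ ⟨a, rfl⟩
    exact hvA a
  · rw [finrank_span_singleton hv]
    omega

theorem surjective_coprod_of_linearIndependent {A₁ : V₁ →L[ℝ] E} {A₂ : V₂ →L[ℝ] E}
    (hA₁ : Function.Injective A₁) (hA₂ : Function.Injective A₂)
    (hd₁ : Module.finrank ℝ E = Module.finrank ℝ V₁ + 1)
    (hd₂ : Module.finrank ℝ E = Module.finrank ℝ V₂ + 1) {v₁ v₂ : E}
    (hv : LinearIndependent ℝ ![v₁, v₂]) (hv₁ : ∀ a, inner ℝ v₁ (A₁ a) = 0)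
    (hv₂ : ∀ a, inner ℝ v₂ (A₂ a) = 0) : Function.Surjective (A₁.coprod A₂) := by
  suffices h : ((A₁ : V₁ →ₗ[ℝ] E).coprod (A₂ : V₂ →ₗ[ℝ] E)).range = ⊤ from
    LinearMap.range_eq_top.1 h
  have hne₁ : v₁ ≠ 0 := hv.ne_zero 0
  have hne₂ : v₂ ≠ 0 := hv.ne_zero 1
  rw [LinearMap.range_coprod, ← Submodule.orthogonal_eq_bot_iff, ← Submodule.inf_orthogonal,
    orthogonal_range_eq_span_singleton hA₁ hd₁ hne₁ hv₁,
    orthogonal_range_eq_span_singleton hA₂ hd₂ hne₂ hv₂, Submodule.eq_bot_iff]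
  rintro w ⟨hw₁, hw₂⟩
  obtain ⟨c₁, rfl⟩ := Submodule.mem_span_singleton.1 hw₁
  obtain ⟨c₂, hc₂⟩ := Submodule.mem_span_singleton.1 hw₂
  have hc₁ := (LinearIndependent.pair_iff.1 hv c₁ (-c₂) (by
    rw [neg_smul, hc₂, add_neg_cancel])).1
  rw [hc₁, zero_smul]

variable [FiniteDimensional ℝ V₁] [FiniteDimensional ℝ V₂]
  [MeasurableSpace E] [BorelSpace E] [MeasurableSpace V₁] [BorelSpace V₁] [MeasurableSpace V₂]
  [BorelSpace V₂] (μ₁ : Measure V₁) [μ₁.IsAddHaarMeasure] (μ₂ : Measure V₂) [μ₂.IsAddHaarMeasure]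
  (ν : Measure E) [ν.IsAddHaarMeasure]

theorem exists_integral_integral_mul_add_eq {Ω₁ : Set V₁} {Ω₂ : Set V₂} {G₁ : V₁ → E}
    {G₂ : V₂ → E} (hΩ₁ : IsOpen Ω₁) (hΩ₂ : IsOpen Ω₂) (hG₁ : ContDiffOn ℝ 1 G₁ Ω₁)
    (hG₂ : ContDiffOn ℝ 1 G₂ Ω₂) (hsurj : ∀ u ∈ Ω₁, ∀ v ∈ Ω₂,
      Function.Surjective ((fderiv ℝ G₁ u).coprod (fderiv ℝ G₂ v)))
    {F₁ : V₁ → ℂ} {F₂ : V₂ → ℂ} (hF₁ : Continuous F₁) (hF₁c : HasCompactSupport F₁)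
    (hF₁Ω : tsupport F₁ ⊆ Ω₁) (hF₂ : Continuous F₂) (hF₂c : HasCompactSupport F₂)
    (hF₂Ω : tsupport F₂ ⊆ Ω₂) :
    ∃ h : E → ℂ, Continuous h ∧ HasCompactSupport h ∧ ∀ ψ : E → ℂ, Continuous ψ →
      ∫ u, F₁ u * ∫ v, F₂ v * ψ (G₁ u + G₂ v) ∂μ₂ ∂μ₁ = ∫ y, h y * ψ y ∂ν := by
  let P : V₁ × V₂ → E := fun p => G₁ p.1 + G₂ p.2
  let F : V₁ × V₂ → ℂ := fun p => F₁ p.1 * F₂ p.2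
  have hP : ContDiffOn ℝ 1 P (Ω₁ ×ˢ Ω₂) :=
    (hG₁.comp contDiffOn_fst fun p hp => hp.1).add (hG₂.comp contDiffOn_snd fun p hp => hp.2)
  have hPsurj : ∀ p ∈ Ω₁ ×ˢ Ω₂, Function.Surjective (fderiv ℝ P p) := fun p hp => by
    have hd₁ := ((hG₁.differentiableOn one_ne_zero).hasFDerivAt (hΩ₁.mem_nhds hp.1)).comp p
      (hasFDerivAt_fst (𝕜 := ℝ) (E := V₁) (F := V₂))
    have hd₂ := ((hG₂.differentiableOn one_ne_zero).hasFDerivAt (hΩ₂.mem_nhds hp.2)).comp p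
      (hasFDerivAt_snd (𝕜 := ℝ) (E := V₁) (F := V₂))
    have hd : fderiv ℝ P p = (fderiv ℝ G₁ p.1).coprod (fderiv ℝ G₂ p.2) :=
      (hd₁.add hd₂).fderiv
    rw [hd]
    exact hsurj p.1 hp.1 p.2 hp.2
  have hF : Continuous F := (hF₁.comp continuous_fst).mul (hF₂.comp continuous_snd)
  have hK : IsCompact (tsupport F₁ ×ˢ tsupport F₂) := hF₁c.isCompact.prod hF₂c.isCompact
  have hzero : ∀ p ∉ tsupport F₁ ×ˢ tsupport F₂, F p = 0 := fun p hp => by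
    rcases not_and_or.1 hp with hp | hp <;> simp [F, image_eq_zero_of_notMem_tsupport hp]
  have hFc : HasCompactSupport F := HasCompactSupport.intro hK hzero
  have hFΩ : tsupport F ⊆ Ω₁ ×ˢ Ω₂ :=
    (tsupport_subset_of_eq_zero_off hK.isClosed hzero).trans (Set.prod_mono hF₁Ω hF₂Ω)
  obtain ⟨h, hh, hhc, hhi⟩ := hasContinuousDensity_of_submersion (μ₁.prod μ₂) ν (hΩ₁.prod hΩ₂) hP
    hPsurj hF hFc hFΩ
  refine ⟨h, hh, hhc, fun ψ hψ => ?_⟩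
  rw [← hhi ψ hψ, integral_prod _ (integrable_mul_comp_of_continuousOn (hΩ₁.prod hΩ₂)
    hP.continuousOn hF hFc hFΩ hψ)]
  simp only [F, P, mul_assoc, integral_const_mul]

end Transversal

section IsCcOn

variable {S : Set E3} {f g : E3 → ℂ}

theorem IsCcOn.zero (S : Set E3) : IsCcOn S 0 :=
  ⟨continuousOn_const, ∅, isCompact_empty, Set.empty_subset _, fun _ _ => rfl⟩

theorem IsCcOn.add (hf : IsCcOn S f) (hg : IsCcOn S g) : IsCcOn S (f + g) := by
  obtain ⟨hfc, K, hK, hKS, hfK⟩ := hf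
  obtain ⟨hgc, L, hL, hLS, hgL⟩ := hg
  refine ⟨hfc.add hgc, K ∪ L, hK.union hL, Set.union_subset hKS hLS, fun x hx => ?_⟩
  rw [Set.mem_union, not_or] at hx
  rw [Pi.add_apply, hfK x hx.1, hgL x hx.2, add_zero]

theorem IsCcOn.neg (hf : IsCcOn S f) : IsCcOn S (-f) := by
  obtain ⟨hfc, K, hK, hKS, hfK⟩ := hf
  exact ⟨hfc.neg, K, hK, hKS, fun x hx => by rw [Pi.neg_apply, hfK x hx, neg_zero]⟩

theorem IsCcOn.sub (hf : IsCcOn S f) (hg : IsCcOn S g) : IsCcOn S (f - g) := by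
  rw [sub_eq_add_neg]
  exact hf.add hg.neg

theorem IsCcOn.aestronglyMeasurable (hS : MeasurableSet S) (hf : IsCcOn S f) :
    AEStronglyMeasurable f (surfaceMeasure S) :=
  hf.1.aestronglyMeasurable hS

theorem IsCcOn.exists_norm_le (hf : IsCcOn S f) : ∃ C, ∀ x, ‖f x‖ ≤ C := by
  obtain ⟨hfc, K, hK, hKS, hfK⟩ := hf
  obtain ⟨C, hC⟩ := hK.exists_bound_of_continuousOn (hfc.mono hKS)
  refine ⟨max C 0, fun x => ?_⟩
  by_cases hx : x ∈ K
  · exact (hC x hx).trans (le_max_left _ _)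
  · rw [hfK x hx, norm_zero]
    exact le_max_right _ _

theorem IsCcOn.memLp (hS : MeasurableSet S) [IsFiniteMeasure (surfaceMeasure S)]
    (hf : IsCcOn S f) (p : ℝ≥0∞) : MemLp f p (surfaceMeasure S) := by
  obtain ⟨C, hC⟩ := hf.exists_norm_le
  exact MemLp.of_bound (hf.aestronglyMeasurable hS) C (Eventually.of_forall hC)

theorem IsCcOn.integrable (hS : MeasurableSet S) [IsFiniteMeasure (surfaceMeasure S)]
    (hf : IsCcOn S f) : Integrable f (surfaceMeasure S) :=
  memLp_one_iff_integrable.1 (hf.memLp hS 1)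

theorem IsCcOn.exists_sum_eq (hf : IsCcOn S f) {p : Set E3 → Prop}
    (h : ∀ x ∈ S, ∃ V, IsOpen V ∧ x ∈ V ∧ p V) :
    ∃ (n : ℕ) (F : Fin n → E3 → ℂ), f = ∑ i, F i ∧ ∀ i, IsCcOn S (F i) ∧
      ∃ V, IsOpen V ∧ p V ∧ ∃ K, IsCompact K ∧ K ⊆ S ∩ V ∧ ∀ x ∉ K, F i x = 0 := by
  obtain ⟨hfc, K, hK, hKS, hfK⟩ := hf
  obtain ⟨n, χ, hχ, hsum⟩ := exists_partition_of_unity_of_isCompact hK fun x hx => h x (hKS hx)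
  refine ⟨n, fun i x => (χ i x : ℂ) * f x, funext fun x => ?_, fun i => ?_⟩
  · rw [Finset.sum_apply, ← Finset.sum_mul]
    by_cases hx : x ∈ K
    · rw [← Complex.ofReal_sum, hsum x hx, Complex.ofReal_one, one_mul]
    · rw [hfK x hx, mul_zero]
  · obtain ⟨V, hVo, hpV, hχV⟩ := hχ i
    have hcomp : IsCompact (K ∩ tsupport (χ i)) := hK.inter_right (isClosed_tsupport _)
    have hzero : ∀ x ∉ K ∩ tsupport (χ i), (χ i x : ℂ) * f x = 0 := fun x hx => by
      rcases not_and_or.1 hx with hx | hx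
      · rw [hfK x hx, mul_zero]
      · rw [image_eq_zero_of_notMem_tsupport hx, Complex.ofReal_zero, zero_mul]
    exact ⟨⟨(Complex.continuous_ofReal.comp (χ i).continuous).continuousOn.mul hfc, _, hcomp,
      Set.inter_subset_left.trans hKS, hzero⟩, V, hVo, hpV, _, hcomp,
      fun x hx => ⟨hKS hx.1, hχV hx.2⟩, hzero⟩

end IsCcOn

section IsContinuousConv

variable {S₁ S₂ : Set E3} {f f' g g' h h' : E3 → ℂ}

theorem IsContinuousConv.neg_left (hh : IsContinuousConv S₁ S₂ f g h) :
    IsContinuousConv S₁ S₂ (-f) g (-h) := by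
  refine ⟨hh.1.neg, hh.2.1.neg, fun ψ hψ hψc => ?_⟩
  have := hh.2.2 ψ hψ hψc
  simp only [surfaceConv, Pi.neg_apply, neg_mul, integral_neg] at this ⊢
  rw [this]

theorem IsContinuousConv.zero_left (g : E3 → ℂ) : IsContinuousConv S₁ S₂ 0 g 0 :=
  ⟨continuous_const, HasCompactSupport.zero, fun ψ _ _ => by simp [surfaceConv]⟩

variable [IsFiniteMeasure (surfaceMeasure S₁)] [IsFiniteMeasure (surfaceMeasure S₂)]
  (h₁ : MeasurableSet S₁) (h₂ : MeasurableSet S₂)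

include h₁ h₂

theorem IsCcOn.integrable_mul_comp_add (hf : IsCcOn S₁ f) (hg : IsCcOn S₂ g) {ψ : E3 → ℂ}
    (hψ : Continuous ψ) (hψc : HasCompactSupport ψ) :
    Integrable (fun p : E3 × E3 => f p.1 * g p.2 * ψ (p.1 + p.2))
      ((surfaceMeasure S₁).prod (surfaceMeasure S₂)) := by
  obtain ⟨C, hC⟩ := hψc.exists_bound_of_continuous hψ
  exact ((hf.integrable h₁).mul_prod (hg.integrable h₂)).mul_bdd (c := C)
    (hψ.comp (continuous_fst.add continuous_snd)).aestronglyMeasurable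
    (Eventually.of_forall fun p => hC _)

theorem surfaceConv_comm (hf : IsCcOn S₁ f) (hg : IsCcOn S₂ g) {ψ : E3 → ℂ} (hψ : Continuous ψ)
    (hψc : HasCompactSupport ψ) : surfaceConv S₁ S₂ f g ψ = surfaceConv S₂ S₁ g f ψ := by
  rw [surfaceConv, integral_integral_swap (hf.integrable_mul_comp_add h₁ h₂ hg hψ hψc)]
  simp only [surfaceConv, mul_comm (f _), add_comm]

theorem surfaceConv_add_left (hf : IsCcOn S₁ f) (hf' : IsCcOn S₁ f') (hg : IsCcOn S₂ g)
    {ψ : E3 → ℂ} (hψ : Continuous ψ) (hψc : HasCompactSupport ψ) :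
    surfaceConv S₁ S₂ (f + f') g ψ = surfaceConv S₁ S₂ f g ψ + surfaceConv S₁ S₂ f' g ψ := by
  have hint := hf.integrable_mul_comp_add h₁ h₂ hg hψ hψc
  have hint' := hf'.integrable_mul_comp_add h₁ h₂ hg hψ hψc
  have hsum := (hf.add hf').integrable_mul_comp_add h₁ h₂ hg hψ hψc
  simp only [surfaceConv]
  rw [← integral_prod _ hint, ← integral_prod _ hint', ← integral_prod _ hsum,
    ← integral_add hint hint']
  simp only [Pi.add_apply, add_mul]

theorem IsContinuousConv.symm (hf : IsCcOn S₁ f) (hg : IsCcOn S₂ g)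
    (hh : IsContinuousConv S₁ S₂ f g h) : IsContinuousConv S₂ S₁ g f h :=
  ⟨hh.1, hh.2.1, fun ψ hψ hψc =>
    (hh.2.2 ψ hψ hψc).trans (surfaceConv_comm h₁ h₂ hf hg hψ.continuous hψc)⟩

theorem IsContinuousConv.add_left (hf : IsCcOn S₁ f) (hf' : IsCcOn S₁ f') (hg : IsCcOn S₂ g)
    (hh : IsContinuousConv S₁ S₂ f g h) (hh' : IsContinuousConv S₁ S₂ f' g h') :
    IsContinuousConv S₁ S₂ (f + f') g (h + h') := by
  refine ⟨hh.1.add hh'.1, hh.2.1.add hh'.2.1, fun ψ hψ hψc => ?_⟩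
  rw [surfaceConv_add_left h₁ h₂ hf hf' hg hψ.continuous hψc, ← hh.2.2 ψ hψ hψc,
    ← hh'.2.2 ψ hψ hψc, ← integral_add]
  · simp only [Pi.add_apply, add_mul]
  · exact (hh.1.mul hψ.continuous).integrable_of_hasCompactSupport hψc.mul_left
  · exact (hh'.1.mul hψ.continuous).integrable_of_hasCompactSupport hψc.mul_left

theorem IsContinuousConv.sub_left (hf : IsCcOn S₁ f) (hf' : IsCcOn S₁ f') (hg : IsCcOn S₂ g)
    (hh : IsContinuousConv S₁ S₂ f g h) (hh' : IsContinuousConv S₁ S₂ f' g h') :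
    IsContinuousConv S₁ S₂ (f - f') g (h - h') := by
  rw [sub_eq_add_neg, sub_eq_add_neg]
  exact hh.add_left h₁ h₂ hf hf'.neg hg hh'.neg_left

theorem IsContinuousConv.sub_right (hf : IsCcOn S₁ f) (hg : IsCcOn S₂ g) (hg' : IsCcOn S₂ g')
    (hh : IsContinuousConv S₁ S₂ f g h) (hh' : IsContinuousConv S₁ S₂ f g' h') :
    IsContinuousConv S₁ S₂ f (g - g') (h - h') :=
  ((hh.symm h₁ h₂ hf hg).sub_left h₂ h₁ hg hg' hf (hh'.symm h₁ h₂ hf hg')).symm h₂ h₁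
    (hg.sub hg') hf

theorem exists_isContinuousConv_sum_left {ι : Type*} [Fintype ι] {f : ι → E3 → ℂ}
    (hf : ∀ i, IsCcOn S₁ (f i)) (hg : IsCcOn S₂ g)
    (hh : ∀ i, ∃ h, IsContinuousConv S₁ S₂ (f i) g h) :
    ∃ h, IsContinuousConv S₁ S₂ (∑ i, f i) g h := by
  refine (Finset.sum_induction f (fun f => IsCcOn S₁ f ∧ ∃ h, IsContinuousConv S₁ S₂ f g h) ?_
    ⟨IsCcOn.zero _, 0, IsContinuousConv.zero_left g⟩ fun i _ => ⟨hf i, hh i⟩).2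
  rintro f f' ⟨hf, h, hh⟩ ⟨hf', h', hh'⟩
  exact ⟨hf.add hf', h + h', hh.add_left h₁ h₂ hf hf' hg hh'⟩

end IsContinuousConv

section Existence

variable {S₁ S₂ : Set E3} {n₁ n₂ : E3 → E3} {f g : E3 → ℂ}

theorem exists_isContinuousConv_of_isSurfaceChart {O₁ O₂ : Set E3}
    {Ω₁ Ω₂ : Set (EuclideanSpace ℝ (Fin 2))} {G₁ G₂ : EuclideanSpace ℝ (Fin 2) → E3}
    (hG₁ : IsSurfaceChart S₁ n₁ O₁ Ω₁ G₁) (hG₂ : IsSurfaceChart S₂ n₂ O₂ Ω₂ G₂)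
    (hO₁ : IsOpen O₁) (hO₂ : IsOpen O₂)
    (hn : ∀ x ∈ S₁, ∀ y ∈ S₂, LinearIndependent ℝ ![n₁ x, n₂ y])
    (hf : ContinuousOn f S₁) (hg : ContinuousOn g S₂) {K₁ K₂ : Set E3} (hK₁ : IsCompact K₁)
    (hK₂ : IsCompact K₂) (hKO₁ : K₁ ⊆ S₁ ∩ O₁) (hKO₂ : K₂ ⊆ S₂ ∩ O₂)
    (hf0 : ∀ x ∉ K₁, f x = 0) (hg0 : ∀ x ∉ K₂, g x = 0) :
    ∃ h, IsContinuousConv S₁ S₂ f g h := by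
  obtain ⟨F₁, hF₁, hF₁c, hF₁Ω, hF₁i⟩ := hG₁.exists_pullback hO₁ hf hK₁ hKO₁ hf0
  obtain ⟨F₂, hF₂, hF₂c, hF₂Ω, hF₂i⟩ := hG₂.exists_pullback hO₂ hg hK₂ hKO₂ hg0
  have hdim : Module.finrank ℝ E3 = Module.finrank ℝ (EuclideanSpace ℝ (Fin 2)) + 1 := by
    rw [finrank_euclideanSpace_fin, finrank_euclideanSpace_fin]
  have hi₁ := hG₁.isInjImmersionOn
  have hi₂ := hG₂.isInjImmersionOn
  obtain ⟨h, hh, hhc, hhi⟩ := exists_integral_integral_mul_add_eq volume volume volume hi₁.isOpen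
    hi₂.isOpen hi₁.contDiffOn hi₂.contDiffOn (fun u hu v hv =>
      surjective_coprod_of_linearIndependent (hi₁.injective_fderiv u hu)
        (hi₂.injective_fderiv v hv) hdim hdim (hn _ (hG₁.mem hu) _ (hG₂.mem hv))
        (hG₁.inner_normal_fderiv u hu) (hG₂.inner_normal_fderiv v hv))
    hF₁ hF₁c hF₁Ω hF₂ hF₂c hF₂Ω
  refine ⟨h, hh, hhc, fun ψ hψ _ => ?_⟩
  calc ∫ v, h v * ψ v
      = ∫ u, F₁ u * ∫ v, F₂ v * ψ (G₁ u + G₂ v) := (hhi ψ hψ.continuous).symm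
    _ = ∫ u, F₁ u * ∫ y, g y * ψ (G₁ u + y) ∂surfaceMeasure S₂ := by
      simp only [surfaceMeasure, hF₂i fun y => ψ (_ + y)]
    _ = ∫ x, f x * ∫ y, g y * ψ (x + y) ∂surfaceMeasure S₂ ∂surfaceMeasure S₁ :=
      (hF₁i fun x => ∫ y, g y * ψ (x + y) ∂surfaceMeasure S₂).symm
    _ = surfaceConv S₁ S₂ f g ψ := by simp only [surfaceConv, mul_assoc, integral_const_mul]

theorem exists_isContinuousConv [IsFiniteMeasure (surfaceMeasure S₁)]
    [IsFiniteMeasure (surfaceMeasure S₂)] (h₁ : MeasurableSet S₁) (h₂ : MeasurableSet S₂)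
    (hS₁ : ∀ σ ∈ S₁, ∃ O, IsOpen O ∧ σ ∈ O ∧
      ∃ (Ω : Set (EuclideanSpace ℝ (Fin 2))) (G : _ → E3), IsSurfaceChart S₁ n₁ O Ω G)
    (hS₂ : ∀ σ ∈ S₂, ∃ O, IsOpen O ∧ σ ∈ O ∧
      ∃ (Ω : Set (EuclideanSpace ℝ (Fin 2))) (G : _ → E3), IsSurfaceChart S₂ n₂ O Ω G)
    (hn : ∀ x ∈ S₁, ∀ y ∈ S₂, LinearIndependent ℝ ![n₁ x, n₂ y])
    (hf : IsCcOn S₁ f) (hg : IsCcOn S₂ g) : ∃ h, IsContinuousConv S₁ S₂ f g h := by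
  obtain ⟨k₁, f', rfl, hf'⟩ := hf.exists_sum_eq hS₁
  obtain ⟨k₂, g', rfl, hg'⟩ := hg.exists_sum_eq hS₂
  refine exists_isContinuousConv_sum_left h₁ h₂ (fun i => (hf' i).1) hg fun i => ?_
  suffices hswap : ∃ h, IsContinuousConv S₂ S₁ (∑ j, g' j) (f' i) h from
    hswap.imp fun h hh => hh.symm h₂ h₁ hg (hf' i).1
  refine exists_isContinuousConv_sum_left h₂ h₁ (fun j => (hg' j).1) (hf' i).1 fun j => ?_
  obtain ⟨hfi, O₁, hO₁, ⟨Ω₁, G₁, hG₁⟩, K₁, hK₁, hKO₁, hf0⟩ := hf' i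
  obtain ⟨hgj, O₂, hO₂, ⟨Ω₂, G₂, hG₂⟩, K₂, hK₂, hKO₂, hg0⟩ := hg' j
  obtain ⟨h, hh⟩ := exists_isContinuousConv_of_isSurfaceChart hG₁ hG₂ hO₁ hO₂ hn hfi.1 hgj.1 hK₁
    hK₂ hKO₁ hKO₂ hf0 hg0
  exact ⟨h, hh.symm h₁ h₂ hfi hgj⟩

end Existence

/-! ### Transversality -/

section Transversality

open scoped Nat in
theorem abs_adjugate_apply_le {ι : Type*} [Fintype ι] [DecidableEq ι] {N : Matrix ι ι ℝ}
    (hN : ∀ i j, |N i j| ≤ 1) (i j : ι) : |N.adjugate i j| ≤ (Fintype.card ι)! := by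
  rw [Matrix.adjugate_apply]
  refine (Matrix.det_le (abv := AbsoluteValue.abs) (x := 1) fun k l => ?_).trans_eq (by simp)
  rw [Matrix.updateRow_apply]
  split_ifs
  · rcases eq_or_ne l i with rfl | hli <;> simp [*]
  · exact hN k l

open scoped Nat in
theorem det_mul_norm_le_of_abs_inner_le {ι : Type*} [Fintype ι] [DecidableEq ι]
    {n : ι → EuclideanSpace ℝ ι} (hn : ∀ i, ‖n i‖ ≤ 1) {w : EuclideanSpace ℝ ι} {a : ℝ}
    (ha : ∀ i, |inner ℝ (n i) w| ≤ a) :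
    (Matrix.of fun k i => n i k).det * ‖w‖ ≤
      √(Fintype.card ι) * (Fintype.card ι * ((Fintype.card ι)! * a)) := by
  set N : Matrix ι ι ℝ := Matrix.of fun i k => n i k with hN
  have hdet : (Matrix.of fun k i => n i k).det = N.det := N.det_transpose
  have hNw : N.mulVec w = fun i => inner ℝ (n i) w := funext fun i => by
    simp [hN, Matrix.mulVec, dotProduct, PiLp.inner_apply, mul_comm]
  have hcramer : ∀ k, |N.det * w k| ≤ Fintype.card ι * ((Fintype.card ι)! * a) := fun k => by
    have h : N.det * w k = ∑ i, N.adjugate k i * inner ℝ (n i) w := by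
      have := congrFun (congrArg (N.adjugate.mulVec) hNw) k
      rwa [Matrix.mulVec_mulVec, Matrix.adjugate_mul, Matrix.smul_mulVec, Matrix.one_mulVec] at this
    calc |N.det * w k| ≤ ∑ i, |N.adjugate k i * inner ℝ (n i) w| :=
          h ▸ Finset.abs_sum_le_sum_abs _ _
      _ ≤ ∑ _i : ι, (Fintype.card ι)! * a := Finset.sum_le_sum fun i _ => by
          rw [abs_mul]
          exact mul_le_mul (abs_adjugate_apply_le
            (fun i k => (PiLp.norm_apply_le (n i) k).trans (hn i)) k i) (ha i) (abs_nonneg _)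
            (Nat.cast_nonneg _)
      _ = Fintype.card ι * ((Fintype.card ι)! * a) := by simp
  rcases isEmpty_or_nonempty ι with hι | hι
  · simp [Subsingleton.elim w 0]
  calc (Matrix.of fun k i => n i k).det * ‖w‖ ≤ ‖N.det • w‖ := by
        rw [norm_smul, hdet]
        gcongr
        exact Real.le_norm_self _
    _ ≤ √(Fintype.card ι) * ⨆ k, ‖inner ℝ (EuclideanSpace.basisFun ι ℝ k) (N.det • w)‖ :=
        (EuclideanSpace.basisFun ι ℝ).norm_le_card_mul_iSup_norm_inner _
    _ ≤ √(Fintype.card ι) * (Fintype.card ι * ((Fintype.card ι)! * a)) := by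
        gcongr
        exact ciSup_le fun k => by
          rw [EuclideanSpace.basisFun_inner]
          exact hcramer k

variable {β : ℝ≥0} {b θ : ℝ}

theorem linearIndependent_normals_of_le_det (hθ : 0 < θ) {S U : Fin 3 → Set E3}
    {Φ : Fin 3 → E3 → ℝ} {n : Fin 3 → E3 → E3}
    (hS : ∀ i, IsSurfacePiece β b (S i) (U i) (Φ i) (n i))
    (hdet : ∀ σ : Fin 3 → E3, (∀ i, σ i ∈ levelSurface (U i) (Φ i)) →
      θ ≤ (Matrix.of fun k i => n i (σ i) k).det) {x y : E3} (hx : x ∈ S 0) (hy : y ∈ S 1) :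
    LinearIndependent ℝ ![n 0 x, n 1 y] := by
  obtain ⟨z, hz⟩ := (hS 2).nonempty
  have hmem : ∀ i, (![x, y, z] : Fin 3 → E3) i ∈ levelSurface (U i) (Φ i) := fun i => by
    fin_cases i
    exacts [(hS 0).subset_levelSurface hx, (hS 1).subset_levelSurface hy,
      (hS 2).subset_levelSurface hz]
  have hcols := Matrix.linearIndependent_cols_of_det_ne_zero (hθ.trans_le (hdet _ hmem)).ne'
  have hpair : (WithLp.linearEquiv 2 ℝ (Fin 3 → ℝ)).toLinearMap ∘ ![n 0 x, n 1 y] =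
      (Matrix.of fun k i => n i ((![x, y, z] : Fin 3 → E3) i) k).col ∘ ![0, 1] :=
    funext (Fin.forall_fin_two.2 ⟨rfl, rfl⟩)
  exact LinearIndependent.of_comp _ (hpair ▸ hcols.comp _ (by decide))

theorem IsSurfacePiece.abs_inner_normal_le_of_norm_sub_le {S U : Set E3} {Φ : E3 → ℝ}
    {n : E3 → E3} (h : IsSurfacePiece β b S U Φ n) {a R : ℝ} (ha : 0 ≤ a)
    (hR : ∀ t, 0 ≤ t → t ≤ R → b * t ^ (β : ℝ) ≤ a) {σ τ w : E3} (hσ : σ ∈ S) (hτ : τ ∈ S) {η : ℝ}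
    (hw : ‖w - (σ - τ)‖ ≤ η) (hwR : ‖w‖ + η ≤ R) :
    |inner ℝ (n σ) w| ≤ a * (‖w‖ + η) + η := by
  have hστ : ‖σ - τ‖ ≤ ‖w‖ + η := by
    rw [norm_sub_rev] at hw
    exact (norm_le_norm_add_norm_sub' _ _).trans (by gcongr)
  calc |inner ℝ (n σ) w| = |inner ℝ (n σ) (σ - τ) + inner ℝ (n σ) (w - (σ - τ))| := by
        rw [← inner_add_right, add_sub_cancel]
    _ ≤ |inner ℝ (n σ) (σ - τ)| + |inner ℝ (n σ) (w - (σ - τ))| := abs_add_le _ _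
    _ ≤ b * ‖σ - τ‖ ^ (β : ℝ) * ‖σ - τ‖ + ‖n σ‖ * ‖w - (σ - τ)‖ :=
        add_le_add (h.abs_inner_normal_sub_le hσ hτ) (abs_real_inner_le_norm _ _)
    _ ≤ a * (‖w‖ + η) + η := by
        rw [h.norm_normal σ (h.subset_levelSurface hσ), one_mul]
        have := hR _ (norm_nonneg _) (hστ.trans hwR)
        gcongr

/-- The points within distance `ε` of each of the translated sets `p i + S i`: the points `z` that
contribute to a convolution on the `S i` mollified at scale `ε`. -/
def nearTranslates {E ι : Type*} [SeminormedAddCommGroup E] (S : ι → Set E) (p : ι → E) (ε : ℝ) :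
    Set E :=
  {z | ∀ i, ∃ σ ∈ S i, ‖z - p i - σ‖ ≤ ε}

theorem exists_norm_sub_le_of_mem_nearTranslates (hβ : 0 < β) (b : ℝ) (hθ : 0 < θ) :
    ∃ δ : ℝ, 0 < δ ∧ ∃ A : ℝ, 0 < A ∧ ∀ S : Fin 3 → Set E3, TransversalTriple β b θ S →
      ∀ (p : Fin 3 → E3) (ε : ℝ), ε ≤ δ → ∀ z ∈ nearTranslates S p ε,
        ∀ z' ∈ nearTranslates S p ε, ‖z - z'‖ ≤ δ → ‖z - z'‖ ≤ A * ε := by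
  obtain ⟨r, hr, hrβ⟩ := exists_mul_rpow_le (NNReal.coe_pos.2 hβ) b (a := θ / 72) (by positivity)
  refine ⟨r / 3, by positivity, 2 + 144 / θ, by positivity, fun S hS p ε hε z hz z' hz' hzz => ?_⟩
  obtain ⟨U, Φ, n, hpiece, hdet⟩ := hS
  choose σ hσ hzσ using hz
  choose τ hτ hzτ using hz'
  have hσL := fun i => (hpiece i).subset_levelSurface (hσ i)
  have hw : ∀ i, ‖(z - z') - (σ i - τ i)‖ ≤ 2 * ε := fun i => by
    rw [show z - z' - (σ i - τ i) = (z - p i - σ i) - (z' - p i - τ i) by abel, two_mul]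
    exact norm_sub_le_of_le (hzσ i) (hzτ i)
  have hle := det_mul_norm_le_of_abs_inner_le (n := fun i => n i (σ i)) (w := z - z')
    (fun i => ((hpiece i).norm_normal _ (hσL i)).le) fun i =>
      (hpiece i).abs_inner_normal_le_of_norm_sub_le (by positivity) hrβ (hσ i) (hτ i) (hw i)
        (by linarith)
  set a := θ / 72 * (‖z - z'‖ + 2 * ε) + 2 * ε
  have ha : 0 ≤ a := by
    have := (norm_nonneg _).trans (hw 0)
    positivity
  have hsqrt : √(3 : ℝ) ≤ 2 := Real.sqrt_le_iff.2 (by norm_num)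
  have hmain : θ * ‖z - z'‖ ≤ θ * ‖z - z'‖ / 2 + θ * ε + 72 * ε := by
    calc θ * ‖z - z'‖ ≤ √3 * (3 * (6 * a)) :=
          (mul_le_mul_of_nonneg_right (hdet σ hσL).1 (norm_nonneg _)).trans hle
      _ ≤ 2 * (3 * (6 * a)) := by gcongr
      _ = θ * ‖z - z'‖ / 2 + θ * ε + 72 * ε := by simp only [a]; ring
  rw [← mul_le_mul_iff_right₀ hθ]
  calc θ * ‖z - z'‖ ≤ 2 * (θ * ε) + 144 * ε := by linarith
    _ = θ * ((2 + 144 / θ) * ε) := by field_simp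

end Transversality

/-! ### The trilinear kernel estimate -/

section CauchySchwarz

variable {X Y Z : Type*} [MeasurableSpace X] [MeasurableSpace Y] [MeasurableSpace Z]
  {μ : Measure X} {ν : Measure Y} {ρ : Measure Z}

theorem sq_lintegral_mul_mul_le {a b k : X → ℝ≥0∞} (ha : Measurable a) (hb : Measurable b)
    (hk : Measurable k) :
    (∫⁻ x, a x * b x * k x ∂μ) ^ 2 ≤ (∫⁻ x, a x ^ 2 * k x ∂μ) * ∫⁻ x, b x ^ 2 * k x ∂μ := by
  have hsq : ∀ t : ℝ≥0∞, (t ^ (1 / 2 : ℝ)) ^ 2 = t := fun t => by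
    rw [← ENNReal.rpow_natCast, ← ENNReal.rpow_mul]
    norm_num
  have hsplit : ∀ x, a x * k x ^ (1 / 2 : ℝ) * (b x * k x ^ (1 / 2 : ℝ)) = a x * b x * k x :=
    fun x => by rw [mul_mul_mul_comm, ← sq, hsq]
  have h := ENNReal.lintegral_mul_le_Lp_mul_Lq μ Real.HolderConjugate.two_two
    (f := fun x => a x * k x ^ (1 / 2 : ℝ)) (g := fun x => b x * k x ^ (1 / 2 : ℝ))
    (ha.mul (hk.pow_const _)).aemeasurable (hb.mul (hk.pow_const _)).aemeasurable
  simp only [Pi.mul_apply, hsplit, ENNReal.rpow_two, mul_pow, hsq] at h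
  calc (∫⁻ x, a x * b x * k x ∂μ) ^ 2
      ≤ ((∫⁻ x, a x ^ 2 * k x ∂μ) ^ (1 / 2 : ℝ) * (∫⁻ x, b x ^ 2 * k x ∂μ) ^ (1 / 2 : ℝ)) ^ 2 :=
        pow_le_pow_left' h 2
    _ = (∫⁻ x, a x ^ 2 * k x ∂μ) * ∫⁻ x, b x ^ 2 * k x ∂μ := by rw [mul_pow, hsq, hsq]

variable [SFinite μ] [SFinite ν] [SFinite ρ] {φ : X → ℝ≥0∞} {γ : Y → ℝ≥0∞}

theorem sq_lintegral_prod_mul_le (hφ : Measurable φ) (hγ : Measurable γ) {K : X × Y → ℝ≥0∞}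
    (hK : Measurable K) :
    (∫⁻ p, φ p.1 * γ p.2 * K p ∂μ.prod ν) ^ 2 ≤
      ∫⁻ p, φ p.1 ^ 2 * γ p.2 ^ 2 * ((∫⁻ y, K (p.1, y) ∂ν) * ∫⁻ x, K (x, p.2) ∂μ) ∂μ.prod ν := by
  have hleft : ∫⁻ p, φ p.1 ^ 2 * K p ∂μ.prod ν = ∫⁻ x, φ x ^ 2 * ∫⁻ y, K (x, y) ∂ν ∂μ := by
    refine (lintegral_prod _ (by fun_prop)).trans (lintegral_congr fun x => ?_)
    exact lintegral_const_mul (φ x ^ 2) (f := fun y => K (x, y)) (hK.comp measurable_prodMk_left)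
  have hright : ∫⁻ p, γ p.2 ^ 2 * K p ∂μ.prod ν = ∫⁻ y, γ y ^ 2 * ∫⁻ x, K (x, y) ∂μ ∂ν := by
    refine (lintegral_prod_symm _ (by fun_prop)).trans (lintegral_congr fun y => ?_)
    exact lintegral_const_mul (γ y ^ 2) (f := fun x => K (x, y)) (hK.comp measurable_prodMk_right)
  have ha : Measurable fun x => φ x ^ 2 * ∫⁻ y, K (x, y) ∂ν :=
    (hφ.pow_const 2).mul hK.lintegral_prod_right'
  have hb : Measurable fun y => γ y ^ 2 * ∫⁻ x, K (x, y) ∂μ :=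
    (hγ.pow_const 2).mul hK.lintegral_prod_left'
  refine (sq_lintegral_mul_mul_le (hφ.comp measurable_fst) (hγ.comp measurable_snd) hK).trans_eq ?_
  simp only [Function.comp_apply]
  rw [hleft, hright, ← lintegral_prod_mul ha.aemeasurable hb.aemeasurable]
  exact lintegral_congr fun p => mul_mul_mul_comm _ _ _ _

theorem lintegral_sq_lintegral_prod_mul_le {K : Z → X × Y → ℝ≥0∞}
    (hK : Measurable (Function.uncurry K)) {D : ℝ≥0∞}
    (hD : ∀ x y, ∫⁻ z, (∫⁻ y', K z (x, y') ∂ν) * (∫⁻ x', K z (x', y) ∂μ) ∂ρ ≤ D)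
    (hφ : Measurable φ) (hγ : Measurable γ) :
    ∫⁻ z, (∫⁻ p, φ p.1 * γ p.2 * K z p ∂μ.prod ν) ^ 2 ∂ρ ≤
      D * ((∫⁻ x, φ x ^ 2 ∂μ) * ∫⁻ y, γ y ^ 2 ∂ν) := by
  let A : Z → X × Y → ℝ≥0∞ := fun z p => (∫⁻ y', K z (p.1, y') ∂ν) * ∫⁻ x', K z (x', p.2) ∂μ
  have hA : Measurable (Function.uncurry A) := by
    refine Measurable.mul ?_ ?_
    · exact Measurable.lintegral_prod_right' (f := fun q : (Z × X × Y) × Y =>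
        Function.uncurry K (q.1.1, q.1.2.1, q.2)) (hK.comp (by fun_prop))
    · exact Measurable.lintegral_prod_right' (f := fun q : (Z × X × Y) × X =>
        Function.uncurry K (q.1.1, q.2, q.1.2.2)) (hK.comp (by fun_prop))
  have hw : Measurable fun p : X × Y => φ p.1 ^ 2 * γ p.2 ^ 2 := by fun_prop
  calc ∫⁻ z, (∫⁻ p, φ p.1 * γ p.2 * K z p ∂μ.prod ν) ^ 2 ∂ρ
      ≤ ∫⁻ z, ∫⁻ p, φ p.1 ^ 2 * γ p.2 ^ 2 * A z p ∂μ.prod ν ∂ρ :=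
        lintegral_mono fun z => sq_lintegral_prod_mul_le hφ hγ (hK.comp measurable_prodMk_left)
    _ = ∫⁻ p, ∫⁻ z, φ p.1 ^ 2 * γ p.2 ^ 2 * A z p ∂ρ ∂μ.prod ν :=
        lintegral_lintegral_swap ((hw.comp measurable_snd).mul hA).aemeasurable
    _ = ∫⁻ p, φ p.1 ^ 2 * γ p.2 ^ 2 * ∫⁻ z, A z p ∂ρ ∂μ.prod ν :=
        lintegral_congr fun p => lintegral_const_mul _ (hA.comp measurable_prodMk_right)
    _ ≤ ∫⁻ p, φ p.1 ^ 2 * γ p.2 ^ 2 * D ∂μ.prod ν := by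
        gcongr with p
        exact hD p.1 p.2
    _ = D * ((∫⁻ x, φ x ^ 2 ∂μ) * ∫⁻ y, γ y ^ 2 ∂ν) := by
        rw [lintegral_mul_const _ hw, lintegral_prod_mul (hφ.pow_const 2).aemeasurable
          (hγ.pow_const 2).aemeasurable, mul_comm]

end CauchySchwarz

section Kernel

theorem exists_measure_le_mul_of_dist_le {E : Type*} [NormedAddCommGroup E] [ProperSpace E]
    [MeasurableSpace E] (d : ℝ) {δ : ℝ} (hδ : 0 < δ) :
    ∃ N : ℕ, ∀ (μ : Measure E) (Z : Set E) (s : E) (r : ℝ) (m : ℝ≥0∞),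
      Z ⊆ Metric.closedBall s d → (∀ z ∈ Z, ∀ z' ∈ Z, dist z z' ≤ δ → dist z z' ≤ r) →
        (∀ z ∈ Z, μ (Metric.closedBall z r) ≤ m) → μ Z ≤ N * m := by
  obtain ⟨t, -, htf, htc⟩ := (isCompact_closedBall (0 : E) d).finite_cover_balls (half_pos hδ)
  lift t to Finset E using htf
  refine ⟨t.card, fun μ Z s r m hZs hZ hm => ?_⟩
  have hcover : Z ⊆ ⋃ c ∈ t, Z ∩ Metric.ball (s + c) (δ / 2) := fun z hz => by
    have hzs : z - s ∈ Metric.closedBall (0 : E) d := by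
      simpa [dist_eq_norm] using hZs hz
    obtain ⟨c, hc, hzc⟩ := Set.mem_iUnion₂.1 (htc hzs)
    refine Set.mem_iUnion₂.2 ⟨c, hc, hz, ?_⟩
    rwa [mem_ball_iff_norm, ← sub_sub, ← mem_ball_iff_norm]
  refine (measure_mono hcover).trans ((measure_biUnion_finset_le _ _).trans ?_)
  rw [← nsmul_eq_mul]
  refine Finset.sum_le_card_nsmul _ _ _ fun c _ => ?_
  rcases (Z ∩ Metric.ball (s + c) (δ / 2)).eq_empty_or_nonempty with he | ⟨z₀, hz₀, hz₀c⟩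
  · simp [he]
  · refine (measure_mono fun z hz => hZ z hz.1 z₀ hz₀ ?_).trans (hm z₀ hz₀)
    exact (dist_triangle_right _ _ (s + c)).trans
      ((add_lt_add hz.2 hz₀c).le.trans_eq (add_halves δ))

variable {β : ℝ≥0} {θ : ℝ}

theorem exists_surfaceMeasure_nearTranslates_le (hβ : 0 < β) (b : ℝ) (hθ : 0 < θ) (d : ℝ) :
    ∃ ε₀ : ℝ, 0 < ε₀ ∧ ∃ C : ℝ≥0, ∀ S : Fin 3 → Set E3, TransversalTriple β b θ S →
      Metric.diam (S 2) ≤ d → ∀ (p : Fin 3 → E3) (ε : ℝ), ε ≤ ε₀ →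
        surfaceMeasure (S 2) (nearTranslates S p ε ∩ S 2) ≤ C * ENNReal.ofReal ε ^ 2 := by
  obtain ⟨r₀, hr₀, M, hM⟩ := exists_surfaceMeasure_closedBall_le hβ b
  obtain ⟨δ, hδ, A, hA, hnear⟩ := exists_norm_sub_le_of_mem_nearTranslates hβ b hθ
  obtain ⟨N, hN⟩ := exists_measure_le_mul_of_dist_le (E := E3) d hδ
  refine ⟨min δ (r₀ / A), by positivity, N * (M * A.toNNReal ^ 2),
    fun S hS hd p ε hε => ?_⟩
  have hεδ : ε ≤ δ := hε.trans (min_le_left _ _)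
  have hεr : A * ε ≤ r₀ := (le_div_iff₀' hA).1 (hε.trans (min_le_right _ _))
  have hnearS := hnear S hS p ε hεδ
  obtain ⟨U, Φ, n, hpiece, -⟩ := hS
  obtain ⟨s, hs⟩ := (hpiece 2).nonempty
  have hcover := hN (surfaceMeasure (S 2)) (nearTranslates S p ε ∩ S 2) s (A * ε)
    (M * ENNReal.ofReal (A * ε) ^ 2)
    (fun z hz => (Metric.dist_le_diam_of_mem (hpiece 2).bounded hz.2 hs).trans hd)
    (fun z hz z' hz' => by simpa only [dist_eq_norm] using hnearS z hz.1 z' hz'.1)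
    fun z _ => hM _ _ _ _ (hpiece 2) z (A * ε) hεr
  refine hcover.trans_eq ?_
  rw [ENNReal.ofReal_mul hA.le, ENNReal.ofReal]
  push_cast
  ring

theorem lintegral_comp_sub_le {E : Type*} [SeminormedAddCommGroup E] [MeasurableSpace E]
    {μ : Measure E} {k : E → ℝ≥0∞} {L : ℝ≥0∞} {ε : ℝ} (hkL : ∀ v, k v ≤ L)
    (hk0 : ∀ v, ε < ‖v‖ → k v = 0) (c : E) :
    ∫⁻ y, k (c - y) ∂μ ≤ L * μ (Metric.closedBall c ε) := by
  refine (lintegral_mono fun y => ?_).trans (lintegral_indicator_const_le _ _)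
  by_cases hy : y ∈ Metric.closedBall c ε
  · rw [Set.indicator_of_mem hy]
    exact hkL _
  · rw [hk0 (c - y) (by rwa [mem_closedBall_iff_norm', not_le] at hy)]
    exact zero_le

theorem exists_mem_norm_sub_le_of_surfaceMeasure_ne_zero {S : Set E3} {c : E3} {ε : ℝ}
    (h : surfaceMeasure S (Metric.closedBall c ε) ≠ 0) : ∃ σ ∈ S, ‖c - σ‖ ≤ ε := by
  rw [surfaceMeasure, Measure.restrict_apply Metric.isClosed_closedBall.measurableSet] at h
  obtain ⟨σ, hσc, hσS⟩ := nonempty_of_measure_ne_zero h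
  exact ⟨σ, hσS, mem_closedBall_iff_norm'.1 hσc⟩

theorem exists_lintegral_kernel_le (hβ : 0 < β) (b : ℝ) (hθ : 0 < θ) (d : ℝ) :
    ∃ ε₀ : ℝ, 0 < ε₀ ∧ ∃ C : ℝ≥0, ∀ S : Fin 3 → Set E3, TransversalTriple β b θ S →
      Metric.diam (S 2) ≤ d → ∀ ε : ℝ, 0 < ε → ε ≤ ε₀ → ∀ (k : E3 → ℝ≥0∞) (L : ℝ≥0∞),
        (∀ v, k v ≤ L) → (∀ v, ε < ‖v‖ → k v = 0) → ∀ p q : E3,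
          ∫⁻ z, (∫⁻ y, k (z - p - y) ∂surfaceMeasure (S 1)) *
            (∫⁻ x, k (z - q - x) ∂surfaceMeasure (S 0)) ∂surfaceMeasure (S 2) ≤
          C * (L ^ 2 * ENNReal.ofReal ε ^ 6) := by
  obtain ⟨r₀, hr₀, M, hM⟩ := exists_surfaceMeasure_closedBall_le hβ b
  obtain ⟨ε₀, hε₀, N, hN⟩ := exists_surfaceMeasure_nearTranslates_le hβ b hθ d
  refine ⟨min r₀ ε₀, by positivity, M ^ 2 * N, fun S hS hd ε hε hεle k L hkL hk0 p q => ?_⟩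
  have hεr : ε ≤ r₀ := hεle.trans (min_le_left _ _)
  have hnear := hN S hS hd ![q, p, 0] ε (hεle.trans (min_le_right _ _))
  obtain ⟨U, Φ, n, hpiece, -⟩ := hS
  have hball : ∀ i c, surfaceMeasure (S i) (Metric.closedBall c ε) ≤ M * ENNReal.ofReal ε ^ 2 :=
    fun i c => hM _ _ _ _ (hpiece i) c ε hεr
  set Z := nearTranslates S ![q, p, 0] ε ∩ S 2
  have hpt : ∀ z ∈ S 2, (∫⁻ y, k (z - p - y) ∂surfaceMeasure (S 1)) *
      (∫⁻ x, k (z - q - x) ∂surfaceMeasure (S 0)) ≤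
        Z.indicator (fun _ => (L * (M * ENNReal.ofReal ε ^ 2)) ^ 2) z := fun z hz => by
    refine (mul_le_mul' (lintegral_comp_sub_le hkL hk0 _)
      (lintegral_comp_sub_le hkL hk0 _)).trans ?_
    by_cases hzZ : z ∈ Z
    · rw [Set.indicator_of_mem hzZ, sq]
      gcongr <;> exact hball _ _
    · rw [Set.indicator_of_notMem hzZ, nonpos_iff_eq_zero]
      contrapose! hzZ
      refine ⟨Fin.forall_fin_succ.2
        ⟨?_, Fin.forall_fin_two.2 ⟨?_, z, hz, by simpa using hε.le⟩⟩, hz⟩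
      · exact exists_mem_norm_sub_le_of_surfaceMeasure_ne_zero
          (right_ne_zero_of_mul (right_ne_zero_of_mul hzZ))
      · exact exists_mem_norm_sub_le_of_surfaceMeasure_ne_zero
          (right_ne_zero_of_mul (left_ne_zero_of_mul hzZ))
  calc _ ≤ ∫⁻ z, Z.indicator (fun _ => (L * (M * ENNReal.ofReal ε ^ 2)) ^ 2) z
          ∂surfaceMeasure (S 2) :=
        lintegral_mono_ae ((ae_restrict_mem (hpiece 2).measurableSet).mono hpt)
    _ ≤ (L * (M * ENNReal.ofReal ε ^ 2)) ^ 2 * surfaceMeasure (S 2) Z :=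
        lintegral_indicator_const_le _ _
    _ ≤ (L * (M * ENNReal.ofReal ε ^ 2)) ^ 2 * (N * ENNReal.ofReal ε ^ 2) := by gcongr
    _ = _ := by
        push_cast
        ring

end Kernel

/-! ### The `L²` estimate for convolutions of continuous densities -/

section Mollification

variable {β : ℝ≥0} {θ : ℝ}

theorem ofReal_bump_normed_le {b : ContDiffBump (0 : E3)} (hb : b.rOut ≤ 2 * b.rIn) (v : E3) :
    ENNReal.ofReal (b.normed volume v) ≤
      ENNReal.ofReal (8 / (b.rOut ^ 3 * volume.real (Metric.ball (0 : E3) 1))) := by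
  refine ENNReal.ofReal_le_ofReal ((b.normed_le_div_measure_closedBall_rOut volume 2 hb v).trans ?_)
  rw [Measure.addHaar_real_closedBall _ _ b.rOut_pos.le, finrank_euclideanSpace_fin]
  norm_num

theorem ofReal_bump_normed_eq_zero {b : ContDiffBump (0 : E3)} {v : E3} (hv : b.rOut < ‖v‖) :
    ENNReal.ofReal (b.normed volume v) = 0 := by
  have hvb : v ∉ Function.support (b.normed volume) := by
    rw [b.support_normed_eq, mem_ball_zero_iff]
    exact hv.not_gt
  rw [Function.notMem_support.1 hvb, ENNReal.ofReal_zero]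

theorem exists_lintegral_sq_mollified_le (hβ : 0 < β) (b : ℝ) (hθ : 0 < θ) (d : ℝ) :
    ∃ ε₀ : ℝ, 0 < ε₀ ∧ ∃ D : ℝ≥0, ∀ S : Fin 3 → Set E3, TransversalTriple β b θ S →
      Metric.diam (S 2) ≤ d → ∀ χ : ContDiffBump (0 : E3), χ.rOut ≤ 2 * χ.rIn → χ.rOut ≤ ε₀ →
        ∀ φ γ : E3 → ℝ≥0∞, Measurable φ → Measurable γ →
          ∫⁻ z, (∫⁻ p : E3 × E3, φ p.1 * γ p.2 *
            ENNReal.ofReal (χ.normed volume (z - p.1 - p.2))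
              ∂(surfaceMeasure (S 0)).prod (surfaceMeasure (S 1))) ^ 2 ∂surfaceMeasure (S 2) ≤
          D * ((∫⁻ x, φ x ^ 2 ∂surfaceMeasure (S 0)) * ∫⁻ y, γ y ^ 2 ∂surfaceMeasure (S 1)) := by
  obtain ⟨ε₀, hε₀, C, hC⟩ := exists_lintegral_kernel_le hβ b hθ d
  set v₃ : ℝ := volume.real (Metric.ball (0 : E3) 1)
  refine ⟨ε₀, hε₀, C * ((8 / v₃) ^ 2).toNNReal, fun S hS hd χ hχ hχε φ γ hφ hγ => ?_⟩
  have hkernel := hC S hS hd χ.rOut χ.rOut_pos hχε (fun v => ENNReal.ofReal (χ.normed volume v))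
    (8 / (χ.rOut ^ 3 * v₃)).toNNReal (ofReal_bump_normed_le hχ)
    fun v hv => ofReal_bump_normed_eq_zero hv
  obtain ⟨U, Φ, n, hpiece, -⟩ := hS
  have : ∀ i, IsFiniteMeasure (surfaceMeasure (S i)) := fun i => (hpiece i).isFiniteMeasure hβ
  have hscale : ((8 / (χ.rOut ^ 3 * v₃)).toNNReal : ℝ≥0∞) ^ 2 * ENNReal.ofReal χ.rOut ^ 6 =
      ((8 / v₃) ^ 2).toNNReal := by
    have hr := χ.rOut_pos
    have : 0 ≤ v₃ := measureReal_nonneg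
    change ENNReal.ofReal _ ^ 2 * _ = ENNReal.ofReal _
    rw [← ENNReal.ofReal_pow (by positivity), ← ENNReal.ofReal_pow hr.le,
      ← ENNReal.ofReal_mul (by positivity)]
    congr 1
    field_simp
  refine lintegral_sq_lintegral_prod_mul_le
    (K := fun z p => ENNReal.ofReal (χ.normed volume (z - p.1 - p.2)))
    (χ.continuous_normed.measurable.ennreal_ofReal.comp (f := fun q : E3 × E3 × E3 =>
      q.1 - q.2.1 - q.2.2) (by fun_prop)) (fun x y => ?_) hφ hγ
  simp only [sub_right_comm _ _ y]
  refine (hkernel x y).trans_eq ?_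
  rw [hscale, ENNReal.coe_mul]

theorem IsCcOn.measurable {S : Set E3} {f : E3 → ℂ} (hf : IsCcOn S f) : Measurable f := by
  classical
  obtain ⟨hfc, K, hK, hKS, hfK⟩ := hf
  have hpiecewise : K.piecewise f 0 = f := funext fun x => by
    by_cases hx : x ∈ K
    · exact Set.piecewise_eq_of_mem _ _ _ hx
    · rw [Set.piecewise_eq_of_notMem _ _ _ hx, hfK x hx, Pi.zero_apply]
  rw [← hpiecewise]
  exact (hfc.mono hKS).measurable_piecewise continuousOn_const hK.measurableSet

theorem IsContinuousConv.enorm_convolution_le {S₁ S₂ : Set E3}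
    [IsFiniteMeasure (surfaceMeasure S₁)] [IsFiniteMeasure (surfaceMeasure S₂)]
    (h₁ : MeasurableSet S₁) (h₂ : MeasurableSet S₂) {f g h : E3 → ℂ} (hf : IsCcOn S₁ f)
    (hg : IsCcOn S₂ g) (hh : IsContinuousConv S₁ S₂ f g h) (χ : ContDiffBump (0 : E3)) (z : E3) :
    ‖convolution (χ.normed volume) h (ContinuousLinearMap.lsmul ℝ ℝ) volume z‖ₑ ≤
      ∫⁻ p : E3 × E3, ‖f p.1‖ₑ * ‖g p.2‖ₑ * ENNReal.ofReal (χ.normed volume (z - p.1 - p.2))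
        ∂(surfaceMeasure S₁).prod (surfaceMeasure S₂) := by
  let ψ : E3 → ℂ := fun v => (χ.normed volume (z - v) : ℂ)
  have hψ : ContDiff ℝ ∞ ψ :=
    Complex.ofRealCLM.contDiff.comp (χ.contDiff_normed.comp (contDiff_const.sub contDiff_id))
  have hψc : HasCompactSupport ψ :=
    ((χ.hasCompactSupport_normed (μ := volume)).comp_homeomorph (Homeomorph.subLeft z)).comp_left
      Complex.ofReal_zero
  have hconv : convolution (χ.normed volume) h (ContinuousLinearMap.lsmul ℝ ℝ) volume z =
      ∫ p : E3 × E3, f p.1 * g p.2 * ψ (p.1 + p.2)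
        ∂(surfaceMeasure S₁).prod (surfaceMeasure S₂) := by
    rw [integral_prod _ (hf.integrable_mul_comp_add h₁ h₂ hg hψ.continuous hψc)]
    refine Eq.trans ?_ (hh.2.2 ψ hψ hψc)
    rw [convolution_eq_swap]
    exact integral_congr_ae (Eventually.of_forall fun v => mul_comm _ _)
  rw [hconv]
  refine (enorm_integral_le_lintegral_enorm _).trans_eq (lintegral_congr fun p => ?_)
  rw [enorm_mul, enorm_mul, ← ofReal_norm (ψ _), Complex.norm_of_nonneg (χ.nonneg_normed _),
    sub_sub]

theorem eLpNorm_two_sq_eq_lintegral {X F : Type*} [MeasurableSpace X] [NormedAddCommGroup F]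
    (μ : Measure X) (f : X → F) : eLpNorm f 2 μ ^ 2 = ∫⁻ x, ‖f x‖ₑ ^ 2 ∂μ := by
  simpa using eLpNorm_nnreal_pow_eq_lintegral (f := f) (μ := μ) (p := 2) two_ne_zero

theorem exists_eLpNorm_bump_convolution_le (hβ : 0 < β) (b : ℝ) (hθ : 0 < θ) (d : ℝ) :
    ∃ ε₀ : ℝ, 0 < ε₀ ∧ ∃ C : ℝ≥0, ∀ S : Fin 3 → Set E3, TransversalTriple β b θ S →
      Metric.diam (S 2) ≤ d → ∀ f g h : E3 → ℂ, IsCcOn (S 0) f → IsCcOn (S 1) g →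
        IsContinuousConv (S 0) (S 1) f g h →
        ∀ χ : ContDiffBump (0 : E3), χ.rOut ≤ 2 * χ.rIn → χ.rOut ≤ ε₀ →
          eLpNorm (convolution (χ.normed volume) h (ContinuousLinearMap.lsmul ℝ ℝ) volume) 2
            (surfaceMeasure (S 2)) ≤
          C * (eLpNorm f 2 (surfaceMeasure (S 0)) * eLpNorm g 2 (surfaceMeasure (S 1))) := by
  obtain ⟨ε₀, hε₀, D, hD⟩ := exists_lintegral_sq_mollified_le hβ b hθ d
  refine ⟨ε₀, hε₀, NNReal.sqrt D, fun S hS hd f g h hf hg hh χ hχ hχε => ?_⟩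
  have hmollified := hD S hS hd χ hχ hχε _ _ hf.measurable.enorm hg.measurable.enorm
  obtain ⟨U, Φ, n, hpiece, -⟩ := hS
  have : ∀ i, IsFiniteMeasure (surfaceMeasure (S i)) := fun i => (hpiece i).isFiniteMeasure hβ
  rw [← ENNReal.pow_le_pow_left_iff two_ne_zero, mul_pow, mul_pow, ← ENNReal.coe_pow,
    NNReal.sq_sqrt]
  simp only [eLpNorm_two_sq_eq_lintegral]
  refine (lintegral_mono fun z => ?_).trans hmollified
  exact pow_le_pow_left' (hh.enorm_convolution_le (hpiece 0).measurableSet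
    (hpiece 1).measurableSet hf hg χ z) 2

theorem exists_eLpNorm_conv_le (hβ : 0 < β) (b : ℝ) (hθ : 0 < θ) (d : ℝ) :
    ∃ C : ℝ≥0, ∀ S : Fin 3 → Set E3, TransversalTriple β b θ S → Metric.diam (S 2) ≤ d →
      ∀ f g h : E3 → ℂ, IsCcOn (S 0) f → IsCcOn (S 1) g → IsContinuousConv (S 0) (S 1) f g h →
        eLpNorm h 2 (surfaceMeasure (S 2)) ≤
          C * (eLpNorm f 2 (surfaceMeasure (S 0)) * eLpNorm g 2 (surfaceMeasure (S 1))) := by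
  obtain ⟨ε₀, hε₀, C, hC⟩ := exists_eLpNorm_bump_convolution_le hβ b hθ d
  refine ⟨C, fun S hS hd f g h hf hg hh => ?_⟩
  let ε : ℕ → ℝ := fun m => ε₀ / (m + 1)
  have hε : ∀ m, 0 < ε m := fun m => by positivity
  have hεlim : Tendsto ε atTop (𝓝 0) :=
    ((tendsto_const_div_atTop_nhds_zero_nat ε₀).comp (tendsto_add_atTop_nat 1)).congr
      fun m => by simp [ε]
  let χ : ℕ → ContDiffBump (0 : E3) := fun m => ⟨ε m / 2, ε m, half_pos (hε m), half_lt_self (hε m)⟩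
  refine Lp.eLpNorm_le_of_ae_tendsto (f := fun m => convolution ((χ m).normed volume) h
    (ContinuousLinearMap.lsmul ℝ ℝ) volume) (Eventually.of_forall fun m => ?_) (fun m => ?_)
    (Eventually.of_forall fun z =>
      ContDiffBump.convolution_tendsto_right_of_continuous (φ := χ) hεlim hh.1 z)
  · exact hC S hS hd f g h hf hg hh (χ m) (mul_div_cancel₀ (ε m) two_ne_zero).ge
      (div_le_self hε₀.le (by simp))
  · exact ((χ m).hasCompactSupport_normed.continuous_convolution_left _
      (χ m).continuous_normed hh.1.locallyIntegrable).aestronglyMeasurable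

end Mollification

/-! ### Extension by density -/

section Extension

variable {A E F G : Type*} [NormedAddCommGroup E] [NormedAddCommGroup F] [NormedAddCommGroup G]

theorem exists_tendsto_comap_of_norm_sub_le [CompleteSpace G] {i : A → E × F} {T : A → G}
    {C : ℝ}
    (hT : ∀ a a', ‖T a - T a'‖ ≤
      C * (‖(i a).1 - (i a').1‖ * ‖(i a).2‖ + ‖(i a').1‖ * ‖(i a).2 - (i a').2‖)) (x : E × F)
    [(comap i (𝓝 x)).NeBot] : ∃ y, Tendsto T (comap i (𝓝 x)) (𝓝 y) := by
  suffices h : Cauchy (map T (comap i (𝓝 x))) from CompleteSpace.complete h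
  rw [cauchy_map_iff, tendsto_uniformity_iff_dist_tendsto_zero]
  refine ⟨inferInstance, squeeze_zero (fun _ => dist_nonneg)
    (fun p => (dist_eq_norm _ _).trans_le (hT p.1 p.2)) ?_⟩
  have hleft : Tendsto (fun p : A × A => i p.1) (comap i (𝓝 x) ×ˢ comap i (𝓝 x)) (𝓝 x) :=
    tendsto_comap.comp tendsto_fst
  have hright : Tendsto (fun p : A × A => i p.2) (comap i (𝓝 x) ×ˢ comap i (𝓝 x)) (𝓝 x) :=
    tendsto_comap.comp tendsto_snd
  have hlim := (((hleft.fst_nhds.sub hright.fst_nhds).norm.mul hleft.snd_nhds.norm).add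
    (hright.fst_nhds.norm.mul (hleft.snd_nhds.sub hright.snd_nhds).norm)).const_mul C
  simpa only [sub_self, norm_zero, zero_mul, mul_zero, add_zero] using hlim

theorem tendsto_toLp_iff {X ι : Type*} [MeasurableSpace X] {μ : Measure X} {p : ℝ≥0∞}
    [Fact (1 ≤ p)] {l : Filter ι} {f : ι → X → E} (hf : ∀ i, MemLp (f i) p μ) (f₀ : Lp E p μ) :
    Tendsto (fun i => (hf i).toLp (f i)) l (𝓝 f₀) ↔
      Tendsto (fun i => eLpNorm (fun x => f i x - f₀ x) p μ) l (𝓝 0) := by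
  conv_lhs => rw [← Lp.toLp_coeFn f₀ (Lp.memLp f₀)]
  exact Lp.tendsto_Lp_iff_tendsto_eLpNorm'' f hf f₀ (Lp.memLp f₀)

end Extension

section Density

variable {S : Set E3}

theorem isCcOn_extend {g : S → ℂ} (hg : Continuous g) (hgc : HasCompactSupport g) :
    IsCcOn S (Function.extend Subtype.val g 0) := by
  have hext : ∀ x : S, Function.extend Subtype.val g 0 (x : E3) = g x := fun x =>
    Subtype.val_injective.extend_apply g 0 x
  refine ⟨?_, Subtype.val '' tsupport g, hgc.isCompact.image continuous_subtype_val, ?_,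
    fun x hx => ?_⟩
  · rw [continuousOn_iff_continuous_domRestrict]
    exact hg.congr fun x => (hext x).symm
  · rintro _ ⟨x, -, rfl⟩
    exact x.2
  · by_cases hxS : x ∈ S
    · rw [hext ⟨x, hxS⟩]
      exact image_eq_zero_of_notMem_tsupport fun h => hx ⟨_, h, rfl⟩
    · exact Function.extend_apply' _ _ _ fun ⟨y, hy⟩ => hxS (hy ▸ y.2)

theorem exists_isCcOn_eLpNorm_sub_le (hS : IsLocallyClosed S) [IsFiniteMeasure (surfaceMeasure S)]
    {p : ℝ≥0∞} (hp : p ≠ ⊤) {f : E3 → ℂ} (hf : MemLp f p (surfaceMeasure S)) {ε : ℝ≥0∞}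
    (hε : ε ≠ 0) : ∃ φ, IsCcOn S φ ∧ eLpNorm (f - φ) p (surfaceMeasure S) ≤ ε := by
  have hSm := measurableSet_of_isLocallyClosed hS
  have hemb : MeasurableEmbedding (Subtype.val : S → E3) := MeasurableEmbedding.subtype_coe hSm
  let μ : Measure S := (surfaceMeasure S).comap Subtype.val
  have hmap : μ.map Subtype.val = surfaceMeasure S := by
    rw [map_comap_subtype_coe hSm, surfaceMeasure, Measure.restrict_restrict hSm, Set.inter_self]
  have : LocallyCompactSpace S := hS.locallyCompactSpace
  have : IsFiniteMeasure μ := ⟨by rw [hemb.comap_apply]; exact measure_lt_top _ _⟩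
  have hfS : MemLp (f ∘ Subtype.val) p μ := by
    rw [← hmap] at hf
    exact hemb.memLp_map_measure_iff.1 hf
  obtain ⟨g, hgc, hge, hg, -⟩ := hfS.exists_hasCompactSupport_eLpNorm_sub_le hp hε
  refine ⟨Function.extend Subtype.val g 0, isCcOn_extend hg hgc, ?_⟩
  rw [← hmap, hemb.eLpNorm_map_measure]
  refine le_of_eq_of_le (congrArg (fun u => eLpNorm u p μ) (funext fun x => ?_)) hge
  simp only [Function.comp_apply, Pi.sub_apply, Subtype.val_injective.extend_apply]

theorem denseRange_toLp_isCcOn (hS : IsLocallyClosed S) (hSm : MeasurableSet S)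
    [IsFiniteMeasure (surfaceMeasure S)] {p : ℝ≥0∞} [Fact (1 ≤ p)] (hp : p ≠ ⊤) :
    DenseRange fun φ : {φ // IsCcOn S φ} => (φ.2.memLp hSm p).toLp φ.1 := by
  refine fun f => EMetric.mem_closure_iff.2 fun ε hε => ?_
  obtain ⟨δ, hδ, hδε⟩ := exists_between hε
  obtain ⟨φ, hφ, hle⟩ := exists_isCcOn_eLpNorm_sub_le hS hp (Lp.memLp f) hδ.ne'
  refine ⟨_, ⟨⟨φ, hφ⟩, rfl⟩, lt_of_le_of_lt ?_ hδε⟩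
  rwa [← Lp.toLp_coeFn f (Lp.memLp f), Lp.edist_toLp_toLp]

end Density

section CcConvolution

/-- Two continuous densities of compact support on `S₁` and `S₂` together with a continuous function
representing their convolution. These triples index the approximations by which the restriction of
a convolution is defined. -/
structure CcConvolution (S₁ S₂ : Set E3) where
  left : E3 → ℂ
  right : E3 → ℂ
  conv : E3 → ℂ
  isCcOn_left : IsCcOn S₁ left
  isCcOn_right : IsCcOn S₂ right
  isContinuousConv : IsContinuousConv S₁ S₂ left right conv

variable {S₁ S₂ S₃ : Set E3} [IsFiniteMeasure (surfaceMeasure S₁)]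
  [IsFiniteMeasure (surfaceMeasure S₂)] [IsFiniteMeasure (surfaceMeasure S₃)]
  (h₁ : MeasurableSet S₁) (h₂ : MeasurableSet S₂)

/-- The two densities as elements of `L²`. -/
noncomputable def CcConvolution.factors (a : CcConvolution S₁ S₂) :
    Lp ℂ 2 (surfaceMeasure S₁) × Lp ℂ 2 (surfaceMeasure S₂) :=
  ((a.isCcOn_left.memLp h₁ 2).toLp a.left, (a.isCcOn_right.memLp h₂ 2).toLp a.right)

variable (S₃) in
omit [IsFiniteMeasure (surfaceMeasure S₁)] [IsFiniteMeasure (surfaceMeasure S₂)] in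
theorem CcConvolution.memLp_conv (a : CcConvolution S₁ S₂) : MemLp a.conv 2 (surfaceMeasure S₃) :=
  a.isContinuousConv.1.memLp_of_hasCompactSupport a.isContinuousConv.2.1

variable (S₃) in
/-- The pointwise restriction of the convolution to a third surface, as an element of `L²`. -/
noncomputable def CcConvolution.restrict (a : CcConvolution S₁ S₂) : Lp ℂ 2 (surfaceMeasure S₃) :=
  (a.memLp_conv S₃).toLp a.conv

theorem isConvRestriction_iff_tendsto {f : Lp ℂ 2 (surfaceMeasure S₁)}
    {g : Lp ℂ 2 (surfaceMeasure S₂)} {F : Lp ℂ 2 (surfaceMeasure S₃)} :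
    IsConvRestriction S₁ S₂ S₃ f g F ↔
      Tendsto (CcConvolution.restrict S₃) (comap (CcConvolution.factors h₁ h₂) (𝓝 (f, g)))
        (𝓝 F) := by
  rw [tendsto_iff_seq_tendsto]
  refine ⟨fun h a ha => ?_, fun h φ γ c hφ hγ hc hφf hγg => ?_⟩
  · rw [tendsto_comap_iff] at ha
    exact (tendsto_toLp_iff (fun k => (a k).memLp_conv S₃) F).2 <|
      h _ _ _ (fun k => (a k).isCcOn_left) (fun k => (a k).isCcOn_right)
        (fun k => (a k).isContinuousConv)
        ((tendsto_toLp_iff (fun k => (a k).isCcOn_left.memLp h₁ 2) f).1 ha.fst_nhds)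
        ((tendsto_toLp_iff (fun k => (a k).isCcOn_right.memLp h₂ 2) g).1 ha.snd_nhds)
  · let a : ℕ → CcConvolution S₁ S₂ := fun k => ⟨φ k, γ k, c k, hφ k, hγ k, hc k⟩
    refine (tendsto_toLp_iff (fun k => (a k).memLp_conv S₃) F).1 (h a (tendsto_comap_iff.2 ?_))
    exact ((tendsto_toLp_iff (fun k => (hφ k).memLp h₁ 2) f).2 hφf).prodMk_nhds
      ((tendsto_toLp_iff (fun k => (hγ k).memLp h₂ 2) g).2 hγg)

variable (hex : ∀ f g : E3 → ℂ, IsCcOn S₁ f → IsCcOn S₂ g → ∃ h, IsContinuousConv S₁ S₂ f g h)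
include hex

theorem CcConvolution.denseRange_factors (hS₁ : IsLocallyClosed S₁) (hS₂ : IsLocallyClosed S₂) :
    DenseRange (CcConvolution.factors h₁ h₂) := by
  refine Dense.mono ?_ ((denseRange_toLp_isCcOn (p := 2) hS₁ h₁ ENNReal.ofNat_ne_top).prodMap
    (denseRange_toLp_isCcOn (p := 2) hS₂ h₂ ENNReal.ofNat_ne_top))
  rintro _ ⟨⟨⟨φ, hφ⟩, ⟨γ, hγ⟩⟩, rfl⟩
  obtain ⟨h, hh⟩ := hex φ γ hφ hγ
  exact ⟨⟨φ, γ, h, hφ, hγ, hh⟩, rfl⟩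

theorem CcConvolution.norm_restrict_sub_le {C : ℝ}
    (hC : ∀ a : CcConvolution S₁ S₂,
      ‖a.restrict S₃‖ ≤ C * (‖(a.factors h₁ h₂).1‖ * ‖(a.factors h₁ h₂).2‖))
    (a a' : CcConvolution S₁ S₂) :
    ‖a.restrict S₃ - a'.restrict S₃‖ ≤
      C * (‖(a.factors h₁ h₂).1 - (a'.factors h₁ h₂).1‖ * ‖(a.factors h₁ h₂).2‖ +
        ‖(a'.factors h₁ h₂).1‖ * ‖(a.factors h₁ h₂).2 - (a'.factors h₁ h₂).2‖) := by
  obtain ⟨φ, γ, h, hφ, hγ, hh⟩ := a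
  obtain ⟨φ', γ', h', hφ', hγ', hh'⟩ := a'
  obtain ⟨k, hk⟩ := hex φ' γ hφ' hγ
  let m : CcConvolution S₁ S₂ := ⟨φ', γ, k, hφ', hγ, hk⟩
  refine (norm_sub_le_norm_sub_add_norm_sub _ (m.restrict S₃) _).trans ?_
  rw [mul_add]
  exact add_le_add
    (hC ⟨φ - φ', γ, h - k, hφ.sub hφ', hγ, hh.sub_left h₁ h₂ hφ hφ' hγ hk⟩)
    (hC ⟨φ', γ - γ', k - h', hφ', hγ.sub hγ', hk.sub_right h₁ h₂ hφ' hγ hγ' hh'⟩)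

theorem exists_isConvRestriction (hS₁ : IsLocallyClosed S₁) (hS₂ : IsLocallyClosed S₂) {C : ℝ≥0}
    (hC : ∀ f g h : E3 → ℂ, IsCcOn S₁ f → IsCcOn S₂ g → IsContinuousConv S₁ S₂ f g h →
      eLpNorm h 2 (surfaceMeasure S₃) ≤
        C * (eLpNorm f 2 (surfaceMeasure S₁) * eLpNorm g 2 (surfaceMeasure S₂)))
    (f : Lp ℂ 2 (surfaceMeasure S₁)) (g : Lp ℂ 2 (surfaceMeasure S₂)) :
    ∃ F : Lp ℂ 2 (surfaceMeasure S₃), IsConvRestriction S₁ S₂ S₃ f g F ∧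
      (∀ F', IsConvRestriction S₁ S₂ S₃ f g F' → F' = F) ∧ ‖F‖ ≤ C * ‖f‖ * ‖g‖ := by
  have h₁ := measurableSet_of_isLocallyClosed hS₁
  have h₂ := measurableSet_of_isLocallyClosed hS₂
  have hbound : ∀ a : CcConvolution S₁ S₂,
      ‖a.restrict S₃‖ ≤ C * (‖(a.factors h₁ h₂).1‖ * ‖(a.factors h₁ h₂).2‖) := fun a => by
    have hf := a.isCcOn_left.memLp h₁ 2
    have hg := a.isCcOn_right.memLp h₂ 2
    simp only [CcConvolution.restrict, CcConvolution.factors, Lp.norm_toLp]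
    rw [← ENNReal.coe_toReal C, ← ENNReal.toReal_mul, ← ENNReal.toReal_mul]
    exact ENNReal.toReal_mono (ENNReal.mul_ne_top ENNReal.coe_ne_top
      (ENNReal.mul_ne_top hf.eLpNorm_ne_top hg.eLpNorm_ne_top))
      (hC _ _ _ a.isCcOn_left a.isCcOn_right a.isContinuousConv)
  have : (comap (CcConvolution.factors h₁ h₂) (𝓝 (f, g))).NeBot := comap_neBot fun t ht =>
    (CcConvolution.denseRange_factors h₁ h₂ hex hS₁ hS₂).mem_nhds ht
  obtain ⟨F, hF⟩ := exists_tendsto_comap_of_norm_sub_le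
    (CcConvolution.norm_restrict_sub_le h₁ h₂ hex hbound) (f, g)
  have hfactors : Tendsto (CcConvolution.factors h₁ h₂)
      (comap (CcConvolution.factors h₁ h₂) (𝓝 (f, g))) (𝓝 (f, g)) := tendsto_comap
  refine ⟨F, (isConvRestriction_iff_tendsto h₁ h₂).2 hF, fun F' hF' =>
    tendsto_nhds_unique ((isConvRestriction_iff_tendsto h₁ h₂).1 hF') hF, ?_⟩
  rw [mul_assoc]
  exact le_of_tendsto_of_tendsto' hF.norm
    ((hfactors.fst_nhds.norm.mul hfactors.snd_nhds.norm).const_mul (C : ℝ)) hbound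

end CcConvolution

theorem theorem1_general (β : ℝ≥0) (hβ : 0 < β) (b θ d : ℝ) (hθ : 0 < θ) :
    ∃ C : ℝ, ∀ S : Fin 3 → Set E3, TransversalTriple β b θ S → Metric.diam (S 2) ≤ d →
      (∀ f g : E3 → ℂ, IsCcOn (S 0) f → IsCcOn (S 1) g →
        ∃ h : E3 → ℂ, IsContinuousConv (S 0) (S 1) f g h) ∧
      ∀ (f : Lp ℂ 2 (surfaceMeasure (S 0))) (g : Lp ℂ 2 (surfaceMeasure (S 1))),
        ∃ F : Lp ℂ 2 (surfaceMeasure (S 2)),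
          IsConvRestriction (S 0) (S 1) (S 2) f g F ∧
          (∀ F', IsConvRestriction (S 0) (S 1) (S 2) f g F' → F' = F) ∧
          ‖F‖ ≤ C * ‖f‖ * ‖g‖ := by
  obtain ⟨C, hC⟩ := exists_eLpNorm_conv_le hβ b hθ d
  refine ⟨C, fun S hS hd => ?_⟩
  have hbound := hC S hS hd
  obtain ⟨U, Φ, n, hpiece, hdet⟩ := hS
  have : ∀ i, IsFiniteMeasure (surfaceMeasure (S i)) := fun i =>
    (hpiece i).isFiniteMeasure hβ
  have hconv : ∀ f g : E3 → ℂ, IsCcOn (S 0) f → IsCcOn (S 1) g →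
      ∃ h, IsContinuousConv (S 0) (S 1) f g h := fun f g =>
    exists_isContinuousConv (hpiece 0).measurableSet (hpiece 1).measurableSet
      (hpiece 0).exists_isSurfaceChart (hpiece 1).exists_isSurfaceChart
      fun _ hx _ hy =>
        linearIndependent_normals_of_le_det hθ hpiece (fun σ hσ => (hdet σ hσ).1) hx hy
  exact ⟨hconv, exists_isConvRestriction hconv (hpiece 0).isLocallyClosed
    (hpiece 1).isLocallyClosed hbound⟩

theorem theorem1 (β : ℝ≥0) (hβ0 : 0 < β) (hβ1 : β ≤ 1) :
    ∃ C : ℝ, ∀ S : Fin 3 → Set E3,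
      TransversalTriple β 1 (1 / 2) S → (∀ i, Metric.diam (S i) ≤ 1) →
      (∀ f g : E3 → ℂ, IsCcOn (S 0) f → IsCcOn (S 1) g →
        ∃ h : E3 → ℂ, IsContinuousConv (S 0) (S 1) f g h) ∧
      ∀ (f : Lp ℂ 2 (surfaceMeasure (S 0))) (g : Lp ℂ 2 (surfaceMeasure (S 1))),
        ∃ F : Lp ℂ 2 (surfaceMeasure (S 2)),
          IsConvRestriction (S 0) (S 1) (S 2) f g F ∧
          (∀ F', IsConvRestriction (S 0) (S 1) (S 2) f g F' → F' = F) ∧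
          ‖F‖ ≤ C * ‖f‖ * ‖g‖ :=
  (theorem1_general β hβ0 1 (1 / 2) 1 one_half_pos).imp fun _ hC S hS hd => hC S hS (hd 2)
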